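/- Let $\mathcal N_0\subset\mathbb R^3$ be a finite connected metric graph embedded in $\mathbb R^3$ with straight edges: there is a finite connected simple graph whose vertices are placed at distinct points of $\mathbb R^3$, each edge is realised as the line segment between the positions of its two end vertices, two distinct edges meet only at vertices they share, and $\mathcal N_0$ is the union of all vertices and edges. For $\varepsilon\ge 0$ let $\mathcal N_\varepsilon=\mathcal N_0+\{x\in\mathbb R^3:\|x\|_2\le\varepsilon\}$ (Minkowski sum), let $\iota_{\mathcal N_\varepsilon}$ be $0$ on $\mathcal N_\varepsilon$ and $+\infty$ elsewhere, and define the cost $c_\varepsilon:\mathbb R^3\times\mathbb R^3\to[0,+\infty]$ by $$c_\varepsilon(x,y)=\inf_{\gamma\in\mathcal C(x,y)}\int_0^1\Big(\|\dot\gamma_t\|^2+\iota_{\mathcal N_\varepsilon}(\gamma_t)\Big)\,dt,$$ where $\mathcal C(x,y)$ is the set of continuous, piecewise continuously differentiable curves $\gamma:[0,1]\to\mathbb R^3$ with $\gamma_0=x$ and $\gamma_1=y$. In particular $c_0$ is the cost for curves confined to the one-dimensional graph $\mathcal N_0$. For probability measures $\mu,\nu$ on $\mathbb R^3$ let $\Pi(\mu,\nu)$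 be the set of their couplings and $$\operatorname{OT}(\mu,\nu,c)=\inf_{\pi\in\Pi(\mu,\nu)}\int_{\mathbb R^3\times\mathbb R^3} c\,d\pi ;$$ a coupling attaining this infimum is called optimal for $(\mu,\nu,c)$. Let $I\subset(0,\infty)$ be an index set with $0\in\overline I$ (for instance $I=(0,\infty)$, or the set of values of a sequence tending to $0$). Let $(\mu_\varepsilon)_{\varepsilon\in I}$, $(\nu_\varepsilon)_{\varepsilon\in I}$ be Borel probability measures on $\mathbb R^3$ with supports contained in $\mathcal N_\varepsilon$ (for instance, equal to $\mathcal N_\varepsilon$), which converge weakly, as $\varepsilon\to0$, to probability measures $\mu_0$, $\nu_0$ supported in $\mathcal N_0$. For each $\varepsilon\in I$ let $\pi_\varepsilon^\star$ be any optimal coupling for $(\mu_\varepsilon,\nu_\varepsilon,c_\varepsilon)$. Then: 1. If $\varepsilon_k\in I$, $\varepsilon_k\to0$, and $\pi^\star_{\varepsilon_k}$ converges weakly to a probability measure $\pi_0$ on $\mathbb R^3\times\mathbb R^3$, then $\pi_0$ is an optimal coupling for $(\mu_0,\nu_0,c_0)$. 2. If there is exactly one optimal coupling $\pi_0^\star$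 for $(\mu_0,\nu_0,c_0)$, then $\pi_\varepsilon^\star\to\pi_0^\star$ weakly as $\varepsilon\to0$ along $I$. -/

import Mathlib

open MeasureTheory Filter Topology
open scoped ENNReal Pointwise

/-- Euclidean three-space, with its Euclidean norm. -/
abbrev Space3 : Type := EuclideanSpace ℝ (Fin 3)

/-- A connected metric graph with straight edges, embedded in three-space. The underlying
combinatorial graph is simple and connected; the edge joining `a` and `b` is realised isometrically
by the segment from `pos a` to `pos b`, so its length is `dist (pos a) (pos b) > 0`. Vertices have
distinct positions, and distinct edges meet only at the vertices that they share. -/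
structure EmbeddedMetricGraph (V : Type*) where
  graph : SimpleGraph V
  connected : graph.Connected
  pos : V → Space3
  pos_injective : Function.Injective pos
  edges_meet : ∀ a b c d : V, graph.Adj a b → graph.Adj c d → s(a, b) ≠ s(c, d) →
    segment ℝ (pos a) (pos b) ∩ segment ℝ (pos c) (pos d) ⊆ pos '' ({a, b} ∩ {c, d})

namespace EmbeddedMetricGraph

variable {V : Type*}

/-- The one-dimensional network `N₀`: all vertices and all edges. -/
def carrier (N : EmbeddedMetricGraph V) : Set Space3 :=
  Set.range N.pos ∪ ⋃ (a : V) (b : V) (_ : N.graph.Adj a b), segment ℝ (N.pos a) (N.pos b)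

/-- The three-dimensional network `N_ε = N₀ + 𝔹_ε`, a Minkowski sum with the closed `ε`-ball.
For `ε = 0` this is `N₀`. -/
def thickened (N : EmbeddedMetricGraph V) (ε : ℝ) : Set Space3 :=
  N.carrier + Metric.closedBall (0 : Space3) ε

end EmbeddedMetricGraph

open Classical in
/-- The penalty `ι_U`, equal to `0` on `U` and to `+∞` off `U`. -/
noncomputable def penalty (U : Set Space3) (x : Space3) : ℝ≥0∞ :=
  if x ∈ U then 0 else ⊤

/-- `γ` is a continuous, piecewise continuously differentiable curve on `[0, 1]`: there are
`0 = t₀ ≤ t₁ ≤ … ≤ tₙ = 1` such that `γ` is `C¹` on each closed interval `[tᵢ, tᵢ₊₁]`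
(one-sidedly at its end points). Values of `γ` outside `[0, 1]` play no role. -/
def IsPiecewiseC1 (γ : ℝ → Space3) : Prop :=
  ContinuousOn γ (Set.Icc 0 1) ∧
    ∃ (n : ℕ) (t : ℕ → ℝ), Monotone t ∧ t 0 = 0 ∧ t n = 1 ∧
      ∀ i < n, ContDiffOn ℝ 1 γ (Set.Icc (t i) (t (i + 1)))

/-- The class `𝒞(x, y)` of piecewise `C¹` curves on `[0, 1]` from `x` to `y`. -/
def curves (x y : Space3) : Set (ℝ → Space3) :=
  {γ | IsPiecewiseC1 γ ∧ γ 0 = x ∧ γ 1 = y}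

/-- The action of `γ` constrained to `U`: `∫₀¹ ‖γ'(t)‖² + ι_U(γ(t)) dt`, a value in `[0, ∞]`.
(For a piecewise `C¹` curve, `deriv γ` is the velocity at all but finitely many times.) -/
noncomputable def action (U : Set Space3) (γ : ℝ → Space3) : ℝ≥0∞ :=
  ∫⁻ t in Set.Icc (0 : ℝ) 1, (‖deriv γ t‖ₑ ^ 2 + penalty U (γ t))

/-- The least-action cost `c(x, y)` in `[0, ∞]` for transport confined to `U`. -/
noncomputable def actionCost (U : Set Space3) (x y : Space3) : ℝ≥0∞ :=
  ⨅ γ ∈ curves x y, action U γ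

/-- The network cost `c_ε`, the least-action cost for curves confined to `N_ε`;
`c₀` is the case `ε = 0`. -/
noncomputable def EmbeddedMetricGraph.cost {V : Type*} (N : EmbeddedMetricGraph V) (ε : ℝ) :
    Space3 → Space3 → ℝ≥0∞ :=
  actionCost (N.thickened ε)

/-- The set `Π(μ, ν)` of couplings of `μ` and `ν`. -/
def couplings (μ ν : ProbabilityMeasure Space3) : Set (ProbabilityMeasure (Space3 × Space3)) :=
  {π | (π : Measure (Space3 × Space3)).fst = μ ∧ (π : Measure (Space3 × Space3)).snd = ν}

/-- The total cost `∫ c dπ`, a value in `[0, ∞]`. -/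
noncomputable def transportCost (c : Space3 → Space3 → ℝ≥0∞)
    (π : ProbabilityMeasure (Space3 × Space3)) : ℝ≥0∞ :=
  ∫⁻ z, c z.1 z.2 ∂(π : Measure (Space3 × Space3))

/-- The optimal transport value `OT(μ, ν, c)`. -/
noncomputable def optimalCost (c : Space3 → Space3 → ℝ≥0∞) (μ ν : ProbabilityMeasure Space3) :
    ℝ≥0∞ :=
  ⨅ π ∈ couplings μ ν, transportCost c π

/-- `π` is an optimal coupling: it attains the infimum defining `OT(μ, ν, c)`. -/
def IsOptimalCoupling (c : Space3 → Space3 → ℝ≥0∞) (μ ν : ProbabilityMeasure Space3)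
    (π : ProbabilityMeasure (Space3 × Space3)) : Prop :=
  π ∈ couplings μ ν ∧ transportCost c π = optimalCost c μ ν

/-! Two facts carry the proof: `c_ε` is uniformly close to a fixed bounded continuous function `F`
that equals `c₀` on `N₀ × N₀`, and a coupling of the weak limits is approximated in `F`-cost by
couplings of the converging marginals.

The square root of the cost is an intrinsic distance with values in `[0, ∞]` (`geoDist_triangle`).
On `N₀` it is finite by connectedness, and it is continuous, since near a point `x` the network
consists of straight pieces containing `x`. Tietze's theorem then supplies `F`. For the upper bound,
points of `N_ε` reach `N₀` along segments of length at most `ε` inside `N_ε`, so a detour through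
`N₀` adds at most `2ε` to the distance (`eventually_cost_le_add`). For the lower bound, curves of
bounded action are equi-Hölder. They have a continuous limit curve in `N₀`, whose length is at most
the limit of their lengths. Squared length is at most action, and intrinsic distance in `N₀` is at
most length (`eventually_sq_le_action`, `eventually_le_cost_add`). Compactness makes both bounds
uniform.

Given a competitor `σ₀` for the limit problem, a partition of unity into small cells yields
couplings of `μ_ε`, `ν_ε` that copy almost all the cell masses of `σ₀`
(`exists_coupling_lintegral_le`). Comparing `π_ε` with them and passing to the limit gives
optimality. Under uniqueness, tightness shows that every ultrafilter limit exists and equals the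
unique optimizer. -/

/-! ### Action of segments and of concatenated curves -/

lemma actionCost_le_action {U : Set Space3} {x y : Space3} {γ : ℝ → Space3} (hγ : γ ∈ curves x y) :
    actionCost U x y ≤ action U γ :=
  iInf₂_le γ hγ

lemma actionCost_anti {U W : Set Space3} (h : U ⊆ W) (x y : Space3) :
    actionCost W x y ≤ actionCost U x y := by
  refine iInf₂_mono fun γ _ => lintegral_mono fun t => ?_
  gcongr
  unfold penalty
  split_ifs with h1 h2
  · exact le_rfl
  · exact bot_le
  · exact absurd (h ‹_›) h1
  · exact le_rfl

lemma actionCost_le_of_segment_subset {U : Set Space3} {x y : Space3} (h : segment ℝ x y ⊆ U) :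
    actionCost U x y ≤ edist x y ^ 2 := by
  have hd : ∀ t : ℝ, HasDerivAt (fun t : ℝ => x + t • (y - x)) (y - x) t := fun t => by
    simpa using ((hasDerivAt_id t).smul_const (y - x)).const_add x
  have hC : ContDiff ℝ 1 (fun t : ℝ => x + t • (y - x)) := by fun_prop
  have hmem : (fun t : ℝ => x + t • (y - x)) ∈ curves x y := by
    refine ⟨⟨hC.continuous.continuousOn, 1, fun i => i, fun i j hij => by simpa using hij,
      by simp, by simp, fun i _ => hC.contDiffOn⟩, by simp, by simp⟩
  refine (actionCost_le_action hmem).trans ?_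
  have : ∀ t ∈ Set.Icc (0 : ℝ) 1, (‖deriv (fun t : ℝ => x + t • (y - x)) t‖ₑ ^ 2 +
      penalty U (x + t • (y - x))) = edist x y ^ 2 := by
    intro t ht
    have hU : x + t • (y - x) ∈ U := h (by rw [segment_eq_image']; exact ⟨t, ht, rfl⟩)
    rw [(hd t).deriv, penalty, if_pos hU, add_zero, edist_comm, edist_eq_enorm_sub]
  unfold action
  rw [setLIntegral_congr_fun measurableSet_Icc this]
  simp

/-- Running `γ` at speed `a` multiplies the kinetic density by `a ^ 2` and divides the time by `a`.
The penalty does not scale, but `1 ≤ a` lets it be absorbed. Agreement on the open interval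
suffices, so the corner of a concatenation never matters. -/
lemma lintegral_action_affine_le {U : Set Space3} {γ σ : ℝ → Space3} {a b c d : ℝ} (ha : 1 ≤ a)
    (hc : a * c + b = 0) (hd : a * d + b = 1)
    (h : Set.EqOn σ (fun t => γ (a * t + b)) (Set.Ioo c d)) :
    ∫⁻ t in Set.Icc c d, (‖deriv σ t‖ₑ ^ 2 + penalty U (σ t)) ≤
      ENNReal.ofReal a * action U γ := by
  have ha0 : 0 < a := by linarith
  have himg : (fun t => a * t + b) '' Set.Ioo c d = Set.Ioo 0 1 := by
    rw [← hc, ← hd]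
    ext s
    constructor
    · rintro ⟨t, ⟨h1, h2⟩, rfl⟩
      exact ⟨by simp; nlinarith, by simp; nlinarith⟩
    · rintro ⟨h1, h2⟩
      refine ⟨(s - b) / a, ⟨?_, ?_⟩, by field_simp; ring⟩
      · rw [lt_div_iff₀ ha0]; linarith
      · rw [div_lt_iff₀ ha0]; linarith
  have hder : ∀ t ∈ Set.Ioo c d, HasDerivWithinAt (fun t => a * t + b) a (Set.Ioo c d) t :=
    fun t _ => by
      simpa using (((hasDerivAt_id t).const_mul a).add_const b).hasDerivWithinAt
  have hinj : Set.InjOn (fun t => a * t + b) (Set.Ioo c d) := fun s _ t _ hst => by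
    have : a * s = a * t := by simpa using hst
    exact mul_left_cancel₀ ha0.ne' this
  have key := lintegral_image_eq_lintegral_abs_deriv_mul measurableSet_Ioo hder hinj
    (fun t => ‖deriv γ t‖ₑ ^ 2 + penalty U (γ t))
  rw [himg] at key
  unfold action
  rw [← restrict_Ioo_eq_restrict_Icc, ← restrict_Ioo_eq_restrict_Icc, key,
    ← lintegral_const_mul' _ _ ENNReal.ofReal_ne_top]
  refine setLIntegral_mono_ae' measurableSet_Ioo (ae_of_all _ fun t ht => ?_)
  have hderiv : deriv σ t = a • deriv γ (a * t + b) := by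
    have : σ =ᶠ[𝓝 t] fun t => γ (a * t + b) := h.eventuallyEq_of_mem (isOpen_Ioo.mem_nhds ht)
    rw [this.deriv_eq]
    have := deriv_comp_mul_left a (fun s => γ (s + b)) t
    rw [this, deriv_comp_add_const]
  rw [hderiv, h ht, abs_of_pos ha0, ← mul_assoc, mul_add, enorm_smul, mul_pow]
  have hea : ‖a‖ₑ = ENNReal.ofReal a := by
    rw [Real.enorm_eq_ofReal ha0.le]
  rw [hea, sq (ENNReal.ofReal a)]
  gcongr
  have : (1 : ℝ≥0∞) ≤ ENNReal.ofReal a := by simpa using ENNReal.ofReal_le_ofReal ha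
  calc penalty U (γ (a * t + b)) = 1 * 1 * penalty U (γ (a * t + b)) := by simp
    _ ≤ _ := by gcongr

lemma IsPiecewiseC1.concat {γ₁ γ₂ : ℝ → Space3} (h₁ : IsPiecewiseC1 γ₁) (h₂ : IsPiecewiseC1 γ₂)
    (h : γ₁ 1 = γ₂ 0) {τ : ℝ} (hτ : 0 < τ) (hτ1 : τ < 1) :
    IsPiecewiseC1 (fun t => if t ≤ τ then γ₁ (t / τ) else γ₂ ((t - τ) / (1 - τ))) := by
  obtain ⟨hc₁, n₁, t₁, hm₁, h0₁, hn₁, hd₁⟩ := h₁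
  obtain ⟨hc₂, n₂, t₂, hm₂, h0₂, hn₂, hd₂⟩ := h₂
  have hτ' : 0 < 1 - τ := by linarith
  set σ : ℝ → Space3 := fun t => if t ≤ τ then γ₁ (t / τ) else γ₂ ((t - τ) / (1 - τ)) with hσ
  have hl : ∀ t, t ≤ τ → σ t = γ₁ (t / τ) := fun t ht => by simp [hσ, ht]
  have hr : ∀ t, τ ≤ t → σ t = γ₂ ((t - τ) / (1 - τ)) := fun t ht => by
    rcases ht.eq_or_lt with rfl | ht
    · simp [hσ, h, hτ.ne']
    · simp [hσ, ht.not_ge]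
  -- The index `n₁` falls in the second branch; both formulas give the junction time `τ` there.
  refine ⟨?_, n₁ + n₂, fun i => if i < n₁ then τ * t₁ i else τ + (1 - τ) * t₂ (i - n₁), ?_, ?_, ?_,
    ?_⟩
  · rw [← Set.Icc_union_Icc_eq_Icc hτ.le hτ1.le]
    refine ContinuousOn.union_of_isClosed ?_ ?_ isClosed_Icc isClosed_Icc
    · refine ContinuousOn.congr (f := fun t => γ₁ (t / τ)) ?_ fun t ht => hl t ht.2
      refine hc₁.comp (by fun_prop) fun t ht => ⟨div_nonneg ht.1 hτ.le, ?_⟩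
      rw [div_le_one hτ]; exact ht.2
    · refine ContinuousOn.congr (f := fun t => γ₂ ((t - τ) / (1 - τ))) ?_ fun t ht => hr t ht.1
      refine hc₂.comp (by fun_prop) fun t ht => ⟨div_nonneg (by linarith [ht.1]) hτ'.le, ?_⟩
      rw [div_le_one hτ']; linarith [ht.2]
  · refine monotone_nat_of_le_succ fun i => ?_
    rcases lt_trichotomy (i + 1) n₁ with hi | hi | hi
    · simp only [show i < n₁ by omega, hi, if_true]
      gcongr
      exact hm₁ (Nat.le_succ i)
    · have : t₁ i ≤ 1 := hn₁ ▸ hm₁ (by omega)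
      simp only [show i < n₁ by omega, hi, if_true, lt_irrefl, if_false, Nat.sub_self, h0₂]
      nlinarith
    · simp only [show ¬ i < n₁ by omega, show ¬ i + 1 < n₁ by omega, if_false]
      gcongr
      exact hm₂ (by omega)
  · rcases Nat.eq_zero_or_pos n₁ with rfl | hp
    · rw [h0₁] at hn₁; norm_num at hn₁
    · simp [hp, h0₁]
  · simp [hn₂]
  · intro i hi
    by_cases hi₁ : i < n₁
    · have hend : (if i + 1 < n₁ then τ * t₁ (i + 1) else τ + (1 - τ) * t₂ (i + 1 - n₁)) =
          τ * t₁ (i + 1) := by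
        split_ifs with h'
        · rfl
        · have : i + 1 = n₁ := by omega
          simp [this, h0₂, hn₁]
      simp only [hi₁, if_true, hend]
      have hle : t₁ (i + 1) ≤ 1 := hn₁ ▸ hm₁ (by omega)
      refine ContDiffOn.congr (f := fun t => γ₁ (t / τ)) ?_ fun t ht => hl t (ht.2.trans ?_)
      · refine (hd₁ i hi₁).comp (by fun_prop) fun t ht => ⟨?_, ?_⟩
        · rw [le_div_iff₀ hτ]; linarith [ht.1]
        · rw [div_le_iff₀ hτ]; linarith [ht.2]
      · nlinarith
    · simp only [hi₁, show ¬ i + 1 < n₁ by omega, if_false]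
      have h0 : 0 ≤ t₂ (i - n₁) := h0₂ ▸ hm₂ (Nat.zero_le _)
      have hidx : i + 1 - n₁ = i - n₁ + 1 := by omega
      refine ContDiffOn.congr (f := fun t => γ₂ ((t - τ) / (1 - τ))) ?_
        fun t ht => hr t (le_trans ?_ ht.1)
      · rw [hidx]
        refine (hd₂ (i - n₁) (by omega)).comp (by fun_prop) fun t ht => ⟨?_, ?_⟩
        · rw [le_div_iff₀ hτ']; linarith [ht.1]
        · rw [div_le_iff₀ hτ']; linarith [ht.2]
      · nlinarith

lemma exists_concat_curve {U : Set Space3} {x y z : Space3} {γ₁ γ₂ : ℝ → Space3}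
    (h₁ : γ₁ ∈ curves x y) (h₂ : γ₂ ∈ curves y z) {τ : ℝ} (hτ : 0 < τ) (hτ1 : τ < 1) :
    ∃ γ ∈ curves x z, action U γ ≤
      ENNReal.ofReal τ⁻¹ * action U γ₁ + ENNReal.ofReal (1 - τ)⁻¹ * action U γ₂ := by
  have hτ' : 0 < 1 - τ := by linarith
  refine ⟨_, ⟨h₁.1.concat h₂.1 (h₁.2.2.trans h₂.2.1.symm) hτ hτ1, ?_, ?_⟩, ?_⟩
  · simp [hτ.le, h₁.2.1]
  · simp [hτ1, hτ'.ne', h₂.2.2]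
  · rw [action, ← Set.Icc_union_Icc_eq_Icc hτ.le hτ1.le]
    refine (lintegral_union_le _ _ _).trans (add_le_add ?_ ?_)
    · refine lintegral_action_affine_le (b := 0) ((one_le_inv₀ hτ).2 hτ1.le) (by simp)
        (by simp [hτ.ne']) fun t ht => ?_
      simp [ht.2.le, div_eq_inv_mul]
    · refine lintegral_action_affine_le (b := -(1 - τ)⁻¹ * τ) ((one_le_inv₀ hτ').2 (by linarith))
        (by ring) (by field_simp; ring) fun t ht => ?_
      simp only [ht.1.not_ge, if_false]
      congr 1
      field_simp
      ring

/-! ### The intrinsic distance -/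

/-- The intrinsic distance in `U`: the square root of the least-action cost. -/
noncomputable def geoDist (U : Set Space3) (x y : Space3) : ℝ≥0∞ :=
  actionCost U x y ^ (1 / 2 : ℝ)

lemma geoDist_sq (U : Set Space3) (x y : Space3) : geoDist U x y ^ 2 = actionCost U x y := by
  rw [geoDist, ← ENNReal.rpow_natCast, ← ENNReal.rpow_mul]
  norm_num

lemma geoDist_le_iff {U : Set Space3} {x y : Space3} {r : ℝ≥0∞} :
    geoDist U x y ≤ r ↔ actionCost U x y ≤ r ^ 2 := by
  rw [← geoDist_sq]
  exact (ENNReal.pow_le_pow_left_iff two_ne_zero).symm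

lemma geoDist_lt_iff {U : Set Space3} {x y : Space3} {r : ℝ≥0∞} :
    geoDist U x y < r ↔ actionCost U x y < r ^ 2 := by
  rw [← geoDist_sq]
  exact (ENNReal.pow_lt_pow_left_iff two_ne_zero).symm

lemma geoDist_anti {U W : Set Space3} (h : U ⊆ W) (x y : Space3) :
    geoDist W x y ≤ geoDist U x y :=
  geoDist_le_iff.2 ((actionCost_anti h x y).trans_eq (geoDist_sq U x y).symm)

lemma geoDist_le_edist {U : Set Space3} {x y : Space3} (h : segment ℝ x y ⊆ U) :
    geoDist U x y ≤ edist x y :=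
  geoDist_le_iff.2 (actionCost_le_of_segment_subset h)

lemma geoDist_triangle (U : Set Space3) (x y z : Space3) :
    geoDist U x z ≤ geoDist U x y + geoDist U y z := by
  by_cases h1 : geoDist U x y = ⊤
  · simp [h1]
  by_cases h2 : geoDist U y z = ⊤
  · simp [h2]
  refine ENNReal.le_of_forall_pos_le_add fun η hη _ => ?_
  have hη2 : (0 : ℝ) < η / 2 := by positivity
  -- The margin `η / 2` provides near-minimizing curves and keeps `p`, `q` positive, so that the
  -- junction time lies strictly inside `(0, 1)` even when a distance vanishes.
  set p : ℝ := (geoDist U x y).toReal + η / 2 with hp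
  set q : ℝ := (geoDist U y z).toReal + η / 2 with hq
  have hp0 : 0 < p := by positivity
  have hq0 : 0 < q := by positivity
  have hlt1 : geoDist U x y < ENNReal.ofReal p := by
    rw [ENNReal.lt_ofReal_iff_toReal_lt h1]; linarith
  have hlt2 : geoDist U y z < ENNReal.ofReal q := by
    rw [ENNReal.lt_ofReal_iff_toReal_lt h2]; linarith
  obtain ⟨γ₁, hγ₁, ha₁⟩ : ∃ γ ∈ curves x y, action U γ < ENNReal.ofReal p ^ 2 := by
    simpa [actionCost, iInf_lt_iff] using geoDist_lt_iff.1 hlt1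
  obtain ⟨γ₂, hγ₂, ha₂⟩ : ∃ γ ∈ curves y z, action U γ < ENNReal.ofReal q ^ 2 := by
    simpa [actionCost, iInf_lt_iff] using geoDist_lt_iff.1 hlt2
  -- The junction time `τ = p / (p + q)` minimizes `p² / τ + q² / (1 - τ)`, with minimum `(p + q)²`.
  have hτ1 : p / (p + q) < 1 := by rw [div_lt_one (by positivity)]; linarith
  obtain ⟨γ, hγ, ha⟩ := exists_concat_curve (U := U) hγ₁ hγ₂ (τ := p / (p + q)) (by positivity) hτ1
  have hle : geoDist U x z ≤ ENNReal.ofReal (p + q) := by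
    rw [geoDist_le_iff]
    refine (actionCost_le_action hγ).trans (ha.trans ?_)
    calc _ ≤ ENNReal.ofReal (p / (p + q))⁻¹ * ENNReal.ofReal p ^ 2 +
          ENNReal.ofReal (1 - p / (p + q))⁻¹ * ENNReal.ofReal q ^ 2 := by gcongr
      _ = ENNReal.ofReal (p + q) ^ 2 := by
        have hτ2 : 0 < 1 - p / (p + q) := by linarith
        rw [← ENNReal.ofReal_pow hp0.le, ← ENNReal.ofReal_pow hq0.le,
          ← ENNReal.ofReal_pow (by positivity), ← ENNReal.ofReal_mul (by positivity),
          ← ENNReal.ofReal_mul (by positivity), ← ENNReal.ofReal_add (by positivity)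
          (by positivity)]
        congr 1
        have : 1 - p / (p + q) = q / (p + q) := by field_simp; ring
        rw [this]
        field_simp
  refine hle.trans_eq ?_
  have : p + q = (geoDist U x y).toReal + (geoDist U y z).toReal + η := by rw [hp, hq]; ring
  rw [this, ENNReal.ofReal_add (by positivity) (by positivity),
    ENNReal.ofReal_add (by positivity) (by positivity), ENNReal.ofReal_toReal h1,
    ENNReal.ofReal_toReal h2, ENNReal.ofReal_coe_nnreal]

/-! ### Length, Hölder bounds and confinement of curves of finite action -/

lemma IsPiecewiseC1.exists_finite_differentiableAt {γ : ℝ → Space3} (h : IsPiecewiseC1 γ) :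
    ∃ s : Set ℝ, s.Finite ∧ ∀ t ∈ Set.Ioo (0 : ℝ) 1 \ s, DifferentiableAt ℝ γ t := by
  obtain ⟨-, n, t, hm, h0, hn, hd⟩ := h
  refine ⟨t '' Set.Iic n, (Set.finite_Iic n).image t, fun x hx => ?_⟩
  have hex : ∃ i, x < t i := ⟨n, by rw [hn]; exact hx.1.2⟩
  classical
  set k := Nat.find hex with hk
  have hxk : x < t k := Nat.find_spec hex
  have hkn : k ≤ n := Nat.find_min' hex (by rw [hn]; exact hx.1.2)
  have hk0 : k ≠ 0 := fun h => by
    rw [h, h0] at hxk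
    exact absurd hx.1.1 hxk.le.not_gt
  obtain ⟨j, hj⟩ := Nat.exists_eq_succ_of_ne_zero hk0
  have hjx : t j ≤ x := not_lt.1 (Nat.find_min hex (by omega))
  have hjx' : t j < x := lt_of_le_of_ne hjx fun h =>
    hx.2 ⟨j, by simp only [Set.mem_Iic]; omega, h⟩
  refine ((hd j (by omega)).differentiableOn one_ne_zero).differentiableAt ?_
  exact Icc_mem_nhds hjx' (by rw [hj] at hxk; exact hxk)

lemma lintegral_enorm_deriv_sq_le_action (U : Set Space3) (γ : ℝ → Space3) :
    ∫⁻ t in Set.Icc (0 : ℝ) 1, ‖deriv γ t‖ₑ ^ 2 ≤ action U γ :=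
  lintegral_mono fun _ => le_self_add

/-- Cauchy–Schwarz against the constant `1`. -/
lemma lintegral_enorm_deriv_sq_le {U : Set Space3} {γ : ℝ → Space3} {a b : ℝ} (ha : 0 ≤ a)
    (hb : b ≤ 1) :
    (∫⁻ t in Set.Ioc a b, ‖deriv γ t‖ₑ) ^ 2 ≤ ENNReal.ofReal (b - a) * action U γ := by
  have hm : AEMeasurable (fun t => ‖deriv γ t‖ₑ) (volume.restrict (Set.Ioc a b)) :=
    (measurable_deriv γ).enorm.aemeasurable
  have h := ENNReal.lintegral_mul_le_Lp_mul_Lq (volume.restrict (Set.Ioc a b))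
    Real.HolderConjugate.two_two hm (aemeasurable_const (b := (1 : ℝ≥0∞)))
  simp only [Pi.mul_apply, mul_one, ENNReal.one_rpow, lintegral_const, one_mul,
    Measure.restrict_apply_univ, Real.volume_Ioc] at h
  calc (∫⁻ t in Set.Ioc a b, ‖deriv γ t‖ₑ) ^ 2 ≤ _ := pow_le_pow_left' h 2
    _ = ENNReal.ofReal (b - a) * ∫⁻ t in Set.Ioc a b, ‖deriv γ t‖ₑ ^ 2 := by
      rw [mul_pow, ← ENNReal.rpow_natCast, ← ENNReal.rpow_mul, ← ENNReal.rpow_natCast,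
        ← ENNReal.rpow_mul, mul_comm]
      norm_num
    _ ≤ _ := by
      gcongr
      exact (lintegral_mono_set (Set.Ioc_subset_Icc_self.trans (Set.Icc_subset_Icc ha hb))).trans
        (lintegral_enorm_deriv_sq_le_action U γ)

lemma edist_le_lintegral_enorm_deriv {U : Set Space3} {γ : ℝ → Space3} (h : IsPiecewiseC1 γ)
    (hU : action U γ ≠ ⊤) {a b : ℝ} (ha : 0 ≤ a) (hab : a ≤ b) (hb : b ≤ 1) :
    edist (γ b) (γ a) ≤ ∫⁻ t in Set.Ioc a b, ‖deriv γ t‖ₑ := by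
  obtain ⟨s, hs, hds⟩ := h.exists_finite_differentiableAt
  have hfin : ∫⁻ t in Set.Ioc a b, ‖deriv γ t‖ₑ ≠ ⊤ := by
    have := (lintegral_enorm_deriv_sq_le (U := U) (γ := γ) ha hb).trans_lt
      (ENNReal.mul_lt_top ENNReal.ofReal_lt_top hU.lt_top)
    intro htop
    rw [htop] at this
    simp at this
  have hint : IntervalIntegrable (deriv γ) volume a b := by
    rw [intervalIntegrable_iff_integrableOn_Ioc_of_le hab]
    exact ⟨(measurable_deriv γ).aestronglyMeasurable, hfin.lt_top⟩
  have hftc := integral_eq_of_hasDerivAt_off_countable_of_le γ (deriv γ) hab hs.countable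
    (h.1.mono (Set.Icc_subset_Icc ha hb))
    (fun x hx => (hds x ⟨⟨ha.trans_lt hx.1.1, hx.1.2.trans_le hb⟩, hx.2⟩).hasDerivAt) hint
  rw [edist_eq_enorm_sub, ← hftc, intervalIntegral.integral_of_le hab]
  exact enorm_integral_le_lintegral_enorm _

lemma edist_sq_le_action {U : Set Space3} {γ : ℝ → Space3} (h : IsPiecewiseC1 γ)
    (hU : action U γ ≠ ⊤) {a b : ℝ} (ha : 0 ≤ a) (hab : a ≤ b) (hb : b ≤ 1) :
    edist (γ b) (γ a) ^ 2 ≤ ENNReal.ofReal (b - a) * action U γ :=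
  (pow_le_pow_left' (edist_le_lintegral_enorm_deriv h hU ha hab hb) 2).trans
    (lintegral_enorm_deriv_sq_le ha hb)

lemma eVariationOn_sq_le_action {U : Set Space3} {γ : ℝ → Space3} (h : IsPiecewiseC1 γ)
    (hU : action U γ ≠ ⊤) :
    eVariationOn γ (Set.Icc 0 1) ^ 2 ≤ action U γ := by
  have key : eVariationOn γ (Set.Icc 0 1) ≤ ∫⁻ t in Set.Ioc (0 : ℝ) 1, ‖deriv γ t‖ₑ := by
    refine iSup_le fun ⟨n, u, hu, hmem⟩ => ?_
    have hsum : ∀ m : ℕ, ∑ i ∈ Finset.range m, edist (γ (u (i + 1))) (γ (u i)) ≤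
        ∫⁻ t in Set.Ioc (u 0) (u m), ‖deriv γ t‖ₑ := by
      intro m
      induction m with
      | zero => simp
      | succ m ih =>
        rw [Finset.sum_range_succ,
          ← Set.Ioc_union_Ioc_eq_Ioc (hu (Nat.zero_le m)) (hu (Nat.le_succ m)),
          lintegral_union measurableSet_Ioc
            (Set.Ioc_disjoint_Ioc_of_le le_rfl)]
        exact add_le_add ih (edist_le_lintegral_enorm_deriv h hU (hmem m).1 (hu (Nat.le_succ m))
          (hmem (m + 1)).2)
    exact (hsum n).trans (lintegral_mono_set (Set.Ioc_subset_Ioc (hmem 0).1 (hmem n).2))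
  refine (pow_le_pow_left' key 2).trans ((lintegral_enorm_deriv_sq_le (U := U) le_rfl le_rfl).trans ?_)
  simp

/-- An excursion out of a closed set at an interior time lasts for an open interval, on which the
infinite penalty integrates to `⊤`. The end points follow by continuity. -/
lemma mem_of_action_ne_top {U : Set Space3} (hUc : IsClosed U) {γ : ℝ → Space3}
    (h : IsPiecewiseC1 γ) (hU : action U γ ≠ ⊤) {t : ℝ} (ht : t ∈ Set.Icc (0 : ℝ) 1) : γ t ∈ U := by
  have hopen : ∀ s ∈ Set.Ioo (0 : ℝ) 1, γ s ∈ U := by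
    intro s hs
    by_contra hcon
    have hcs : ContinuousAt γ s := h.1.continuousAt (Icc_mem_nhds hs.1 hs.2)
    obtain ⟨l, u, hlu, hsub⟩ := mem_nhds_iff_exists_Ioo_subset.1
      (inter_mem (hcs (hUc.isOpen_compl.mem_nhds hcon)) (Icc_mem_nhds hs.1 hs.2))
    apply hU
    rw [eq_top_iff]
    have hpos : 0 < u - l := by linarith [hlu.1, hlu.2]
    calc (⊤ : ℝ≥0∞) = ⊤ * volume (Set.Ioo l u) := by
          rw [Real.volume_Ioo, ENNReal.top_mul (by simpa using hpos)]
      _ = ∫⁻ _ in Set.Ioo l u, ⊤ := by rw [setLIntegral_const]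
      _ ≤ ∫⁻ t in Set.Ioo l u, (‖deriv γ t‖ₑ ^ 2 + penalty U (γ t)) := by
          refine setLIntegral_mono_ae' measurableSet_Ioo (ae_of_all _ fun t ht => ?_)
          have : γ t ∉ U := (hsub ht).1
          simp [penalty, this]
      _ ≤ _ := lintegral_mono_set fun t ht => (hsub ht).2
  have hcl : closure (Set.Ioo (0 : ℝ) 1) = Set.Icc 0 1 := closure_Ioo zero_ne_one
  have himg := ContinuousOn.image_closure (s := Set.Ioo (0 : ℝ) 1) (f := γ) (by rw [hcl]; exact h.1)
  rw [hcl] at himg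
  have hsub : γ '' Set.Ioo 0 1 ⊆ U := by rintro _ ⟨s, hs, rfl⟩; exact hopen s hs
  exact hUc.closure_subset_iff.2 hsub (himg ⟨t, ht, rfl⟩)

/-! ### Geometry of the network -/

lemma isCompact_segment (x y : Space3) : IsCompact (segment ℝ x y) := by
  rw [segment_eq_image']
  exact isCompact_Icc.image (by fun_prop)

namespace EmbeddedMetricGraph

variable {V : Type*} (N : EmbeddedMetricGraph V)

/-- Diagonal pairs contribute the vertices as degenerate segments, so vertices and edges form one
family of compact convex sets. -/
lemma carrier_eq_biUnion_segment :
    N.carrier = ⋃ p ∈ {p : V × V | p.1 = p.2 ∨ N.graph.Adj p.1 p.2},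
      segment ℝ (N.pos p.1) (N.pos p.2) := by
  ext x
  simp only [carrier, Set.mem_union, Set.mem_range, Set.mem_iUnion, Set.mem_ofPred_eq, Prod.exists]
  constructor
  · rintro (⟨a, rfl⟩ | ⟨a, b, h, hx⟩)
    · exact ⟨a, a, Or.inl rfl, left_mem_segment ℝ _ _⟩
    · exact ⟨a, b, Or.inr h, hx⟩
  · rintro ⟨a, b, rfl | h, hx⟩
    · rw [segment_same] at hx
      exact Or.inl ⟨a, hx.symm⟩
    · exact Or.inr ⟨a, b, h, hx⟩

lemma isCompact_carrier [Finite V] : IsCompact N.carrier := by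
  rw [carrier_eq_biUnion_segment]
  exact (Set.toFinite _).isCompact_biUnion fun p _ => isCompact_segment _ _

lemma isCompact_thickened [Finite V] (ε : ℝ) : IsCompact (N.thickened ε) :=
  N.isCompact_carrier.add (isCompact_closedBall 0 ε)

lemma thickened_zero : N.thickened 0 = N.carrier := by
  simp [thickened]

lemma thickened_mono {ε δ : ℝ} (h : ε ≤ δ) : N.thickened ε ⊆ N.thickened δ :=
  Set.add_subset_add_left (Metric.closedBall_subset_closedBall h)

lemma carrier_subset_thickened {ε : ℝ} (h : 0 ≤ ε) : N.carrier ⊆ N.thickened ε :=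
  N.thickened_zero ▸ N.thickened_mono h

lemma exists_mem_carrier_segment_subset {ε : ℝ} {x : Space3} (hx : x ∈ N.thickened ε) :
    ∃ z ∈ N.carrier, dist x z ≤ ε ∧ segment ℝ x z ⊆ N.thickened ε := by
  obtain ⟨z, hz, v, hv, rfl⟩ := hx
  have hv' : ‖v‖ ≤ ε := by simpa using hv
  have hball : Metric.closedBall z ε ⊆ N.thickened ε := fun w hw =>
    ⟨z, hz, w - z, by simpa [dist_eq_norm] using hw, by simp⟩
  refine ⟨z, hz, by simpa using hv', ((convex_closedBall z ε).segment_subset ?_ ?_).trans hball⟩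
  · simpa using hv'
  · exact Metric.mem_closedBall_self ((norm_nonneg v).trans hv')

/-- Each of the finitely many segments missing `x` is closed, hence misses a neighbourhood of `x`. A
nearby point of the network thus shares a segment with `x`, and convexity concludes. -/
lemma eventually_segment_subset_carrier [Finite V] (x : Space3) :
    ∀ᶠ y in 𝓝 x, y ∈ N.carrier → segment ℝ x y ⊆ N.carrier := by
  have hloc : ∀ p ∈ {p : V × V | p.1 = p.2 ∨ N.graph.Adj p.1 p.2}, ∀ᶠ y in 𝓝 x,
      y ∈ segment ℝ (N.pos p.1) (N.pos p.2) → x ∈ segment ℝ (N.pos p.1) (N.pos p.2) := by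
    intro p _
    by_cases hx : x ∈ segment ℝ (N.pos p.1) (N.pos p.2)
    · exact Eventually.of_forall fun _ _ => hx
    · filter_upwards [(isCompact_segment (N.pos p.1) (N.pos p.2)).isClosed.isOpen_compl.mem_nhds hx]
        with y hy hy'
      exact absurd hy' hy
  rw [← eventually_all_finite (Set.toFinite _)] at hloc
  filter_upwards [hloc] with y hy hyN
  rw [carrier_eq_biUnion_segment] at hyN ⊢
  obtain ⟨p, hp, hyp⟩ := Set.mem_iUnion₂.1 hyN
  exact ((convex_segment _ _).segment_subset (hy p hp hyp) hyp).trans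
    (Set.subset_biUnion_of_mem (u := fun p : V × V => segment ℝ (N.pos p.1) (N.pos p.2)) hp)

lemma geoDist_pos_ne_top (a b : V) : geoDist N.carrier (N.pos a) (N.pos b) ≠ ⊤ := by
  obtain ⟨w⟩ := N.connected.preconnected a b
  induction w with
  | nil =>
    refine ne_top_of_le_ne_top (edist_ne_top (N.pos _) (N.pos _)) (geoDist_le_edist ?_)
    rw [segment_same, Set.singleton_subset_iff]
    exact Or.inl ⟨_, rfl⟩
  | cons h _ ih =>
    refine ne_top_of_le_ne_top (ENNReal.add_ne_top.2 ⟨?_, ih⟩) (geoDist_triangle _ _ _ _)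
    refine ne_top_of_le_ne_top (edist_ne_top _ _) (geoDist_le_edist fun y hy => Or.inr ?_)
    simp only [Set.mem_iUnion]
    exact ⟨_, _, h, hy⟩

lemma exists_segment_pos_subset_carrier {x : Space3} (hx : x ∈ N.carrier) :
    ∃ a, segment ℝ x (N.pos a) ⊆ N.carrier := by
  rw [carrier_eq_biUnion_segment] at hx ⊢
  obtain ⟨p, hp, hxp⟩ := Set.mem_iUnion₂.1 hx
  exact ⟨p.1, ((convex_segment _ _).segment_subset hxp (left_mem_segment ℝ _ _)).trans
    (Set.subset_biUnion_of_mem (u := fun p : V × V => segment ℝ (N.pos p.1) (N.pos p.2)) hp)⟩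

lemma geoDist_carrier_ne_top {x y : Space3} (hx : x ∈ N.carrier) (hy : y ∈ N.carrier) :
    geoDist N.carrier x y ≠ ⊤ := by
  obtain ⟨a, ha⟩ := N.exists_segment_pos_subset_carrier hx
  obtain ⟨b, hb⟩ := N.exists_segment_pos_subset_carrier hy
  refine ne_top_of_le_ne_top (ENNReal.add_ne_top.2 ⟨?_, ENNReal.add_ne_top.2
    ⟨N.geoDist_pos_ne_top a b, ?_⟩⟩) ((geoDist_triangle _ x (N.pos a) y).trans
      (add_le_add_right (geoDist_triangle _ (N.pos a) (N.pos b) y) _))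
  · exact ne_top_of_le_ne_top (edist_ne_top _ _) (geoDist_le_edist ha)
  · exact ne_top_of_le_ne_top (edist_ne_top _ _) (geoDist_le_edist (segment_symm ℝ y _ ▸ hb))

lemma eventually_geoDist_le_edist [Finite V] (x : Space3) :
    ∀ᶠ y in 𝓝 x, y ∈ N.carrier →
      geoDist N.carrier x y ≤ edist x y ∧ geoDist N.carrier y x ≤ edist x y := by
  filter_upwards [N.eventually_segment_subset_carrier x] with y hy hyN
  refine ⟨geoDist_le_edist (hy hyN), ?_⟩
  rw [edist_comm]
  exact geoDist_le_edist (segment_symm ℝ x y ▸ hy hyN)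

/-- The intrinsic distance in the network is at most the length of any continuous curve. -/
lemma geoDist_le_eVariationOn [Finite V] {γ : ℝ → Space3}
    (hc : ContinuousOn γ (Set.Icc 0 1)) (hN : ∀ t ∈ Set.Icc (0 : ℝ) 1, γ t ∈ N.carrier) :
    geoDist N.carrier (γ 0) (γ 1) ≤ eVariationOn γ (Set.Icc 0 1) := by
  have hloc : ∀ t ∈ Set.Icc (0 : ℝ) 1, ∃ η > 0, ∀ s ∈ Set.Icc (0 : ℝ) 1, |s - t| < η →
      geoDist N.carrier (γ t) (γ s) ≤ edist (γ t) (γ s) ∧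
        geoDist N.carrier (γ s) (γ t) ≤ edist (γ t) (γ s) := by
    intro t ht
    have := (hc t ht).eventually (N.eventually_geoDist_le_edist (γ t))
    rw [eventually_nhdsWithin_iff, Metric.eventually_nhds_iff] at this
    obtain ⟨η, hη, h⟩ := this
    exact ⟨η, hη, fun s hs hst => h hst hs (hN s hs)⟩
  -- Continuous induction: `A` contains its supremum `T`, and a later time if `T < 1`. Both moves
  -- compare `γ T` with a nearby point, the only kind of pair that the local bound at `T` covers.
  set A : Set ℝ := {t | t ∈ Set.Icc (0 : ℝ) 1 ∧
    geoDist N.carrier (γ 0) (γ t) ≤ eVariationOn γ (Set.Icc 0 t)} with hA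
  have step : ∀ s ∈ A, ∀ t ∈ Set.Icc (0 : ℝ) 1, s ≤ t →
      geoDist N.carrier (γ s) (γ t) ≤ edist (γ s) (γ t) → t ∈ A := by
    intro s hs t ht hst h
    refine ⟨ht, (geoDist_triangle _ _ (γ s) _).trans ?_⟩
    have hsum := eVariationOn.Icc_add_Icc γ (s := Set.univ) hs.1.1 hst (Set.mem_univ s)
    simp only [Set.univ_inter] at hsum
    rw [← hsum]
    exact add_le_add hs.2 (h.trans (eVariationOn.edist_le γ ⟨le_rfl, hst⟩ ⟨hst, le_rfl⟩))
  have h0 : (0 : ℝ) ∈ A := by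
    obtain ⟨η, hη, h⟩ := hloc 0 ⟨le_rfl, zero_le_one⟩
    refine ⟨⟨le_rfl, zero_le_one⟩, ?_⟩
    have := (h 0 ⟨le_rfl, zero_le_one⟩ (by simpa using hη)).1
    rw [edist_self] at this
    exact this.trans bot_le
  have hbdd : BddAbove A := ⟨1, fun t ht => ht.1.2⟩
  set T := sSup A with hT
  have hT01 : T ∈ Set.Icc (0 : ℝ) 1 := ⟨le_csSup hbdd h0, csSup_le ⟨0, h0⟩ fun t ht => ht.1.2⟩
  obtain ⟨η, hη, hηT⟩ := hloc T hT01
  have hTA : T ∈ A := by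
    obtain ⟨s, hs, hsT⟩ := exists_lt_of_lt_csSup ⟨0, h0⟩ (show T - η < T by linarith)
    have hsle : s ≤ T := le_csSup hbdd hs
    refine step s hs T hT01 hsle ?_
    rw [edist_comm]
    exact (hηT s hs.1 (by rw [abs_lt]; constructor <;> linarith)).2
  rcases hT01.2.eq_or_lt with h1 | h1
  · rw [h1] at hTA
    exact hTA.2
  · have hs1 : min (T + η / 2) 1 ∈ Set.Icc (0 : ℝ) 1 :=
      ⟨le_min (by linarith [hT01.1]) zero_le_one, min_le_right _ _⟩
    have hTs : T < min (T + η / 2) 1 := lt_min (by linarith) h1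
    have hle : min (T + η / 2) 1 ≤ T + η / 2 := min_le_left _ _
    have := step T hTA _ hs1 hTs.le
      (hηT _ hs1 (by rw [abs_lt]; constructor <;> linarith)).1
    exact absurd (le_csSup hbdd this) hTs.not_ge

end EmbeddedMetricGraph

/-! ### Continuity and extension of the network cost -/

namespace EmbeddedMetricGraph

variable {V : Type*} (N : EmbeddedMetricGraph V)

/-- Moving both end points changes the distance by at most the intrinsic displacements, which are
locally bounded by the Euclidean ones. -/
lemma continuousOn_toReal_geoDist_carrier [Finite V] :
    ContinuousOn (fun z : Space3 × Space3 => (geoDist N.carrier z.1 z.2).toReal)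
      (N.carrier ×ˢ N.carrier) := by
  rintro ⟨x, y⟩ ⟨hx, hy⟩
  rw [ContinuousWithinAt, tendsto_iff_dist_tendsto_zero]
  have hlim : Tendsto (fun z : Space3 × Space3 => dist x z.1 + dist y z.2)
      (𝓝[N.carrier ×ˢ N.carrier] (x, y)) (𝓝 0) := by
    have : Continuous fun z : Space3 × Space3 => dist x z.1 + dist y z.2 := by fun_prop
    simpa using (this.tendsto (x, y)).mono_left nhdsWithin_le_nhds
  refine squeeze_zero' (Eventually.of_forall fun _ => dist_nonneg) ?_ hlim
  have h1 : ∀ᶠ z : Space3 × Space3 in 𝓝[N.carrier ×ˢ N.carrier] (x, y), z.1 ∈ N.carrier →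
      geoDist N.carrier x z.1 ≤ edist x z.1 ∧ geoDist N.carrier z.1 x ≤ edist x z.1 :=
    (continuous_fst.tendsto (x, y)).mono_left nhdsWithin_le_nhds |>.eventually
      (N.eventually_geoDist_le_edist x)
  have h2 : ∀ᶠ z : Space3 × Space3 in 𝓝[N.carrier ×ˢ N.carrier] (x, y), z.2 ∈ N.carrier →
      geoDist N.carrier y z.2 ≤ edist y z.2 ∧ geoDist N.carrier z.2 y ≤ edist y z.2 :=
    (continuous_snd.tendsto (x, y)).mono_left nhdsWithin_le_nhds |>.eventually
      (N.eventually_geoDist_le_edist y)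
  have tri : ∀ a b c d : Space3, a ∈ N.carrier → b ∈ N.carrier → c ∈ N.carrier → d ∈ N.carrier →
      geoDist N.carrier a b ≤ edist a b → geoDist N.carrier c d ≤ edist d c →
      (geoDist N.carrier a d).toReal ≤ dist a b + dist d c + (geoDist N.carrier b c).toReal := by
    intro a b c d _ hb hc _ hab hcd
    have hne := N.geoDist_carrier_ne_top hb hc
    have : geoDist N.carrier a d ≤ edist a b + (geoDist N.carrier b c + edist d c) :=
      (geoDist_triangle _ a b d).trans
        (add_le_add hab ((geoDist_triangle _ b c d).trans (add_le_add le_rfl hcd)))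
    have h := ENNReal.toReal_mono (by simp [edist_ne_top, hne]) this
    rw [ENNReal.toReal_add (edist_ne_top _ _) (by simp [edist_ne_top, hne]),
      ENNReal.toReal_add hne (edist_ne_top _ _), ← dist_edist, ← dist_edist] at h
    linarith
  filter_upwards [h1, h2, self_mem_nhdsWithin] with z hz1 hz2 hz
  obtain ⟨hz1a, hz1b⟩ := hz1 hz.1
  obtain ⟨hz2a, hz2b⟩ := hz2 hz.2
  have e1 := tri z.1 x y z.2 hz.1 hx hy hz.2 (by rwa [edist_comm]) (by rwa [edist_comm])
  have e2 := tri x z.1 z.2 y hx hz.1 hz.2 hy hz1a hz2b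
  rw [dist_comm z.1 x, dist_comm z.2 y] at e1
  rw [Real.dist_eq, abs_le]
  constructor <;> linarith

/-- The least-action cost of the network extends to a bounded continuous function. -/
lemma exists_boundedContinuous_extension [Finite V] :
    ∃ F : BoundedContinuousFunction (Space3 × Space3) NNReal,
      ∀ x ∈ N.carrier, ∀ y ∈ N.carrier, (F (x, y) : ℝ≥0∞) = geoDist N.carrier x y ^ 2 := by
  have hK : IsCompact (N.carrier ×ˢ N.carrier) := N.isCompact_carrier.prod N.isCompact_carrier
  have : CompactSpace ↥(N.carrier ×ˢ N.carrier) := isCompact_iff_compactSpace.1 hK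
  have hcont := (continuousOn_iff_continuous_domRestrict.1
    (N.continuousOn_toReal_geoDist_carrier)).pow 2
  obtain ⟨G, -, hG⟩ := BoundedContinuousFunction.exists_norm_eq_domRestrict_eq_of_closed
    (BoundedContinuousFunction.mkOfCompact ⟨_, hcont⟩) hK.isClosed
  refine ⟨G.nnrealPart, fun x hx y hy => ?_⟩
  have h := DFunLike.congr_fun hG ⟨(x, y), ⟨hx, hy⟩⟩
  have h' : G (x, y) = (geoDist N.carrier x y).toReal ^ 2 := h
  rw [BoundedContinuousFunction.nnrealPart_coeFn_eq, Function.comp_apply, h',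
    ← ENNReal.ofReal, ENNReal.ofReal_pow ENNReal.toReal_nonneg,
    ENNReal.ofReal_toReal (N.geoDist_carrier_ne_top hx hy)]

/-! ### Limits of points and curves in shrinking neighbourhoods -/

lemma mem_carrier_of_tendsto [Finite V] {ι : Type*} {L : Filter ι} [L.NeBot] {e : ι → ℝ}
    (he : Tendsto e L (𝓝 0)) {p : ι → Space3} (hp : ∀ᶠ i in L, p i ∈ N.thickened (e i))
    {x : Space3} (hx : Tendsto p L (𝓝 x)) : x ∈ N.carrier := by
  have h : ∀ i, ∃ z, p i ∈ N.thickened (e i) → z ∈ N.carrier ∧ dist (p i) z ≤ e i := fun i => by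
    by_cases hi : p i ∈ N.thickened (e i)
    · obtain ⟨z, hz, hd, -⟩ := N.exists_mem_carrier_segment_subset hi
      exact ⟨z, fun _ => ⟨hz, hd⟩⟩
    · exact ⟨0, fun h => absurd h hi⟩
  choose z hz using h
  have hlim : Tendsto z L (𝓝 x) := by
    refine hx.congr_dist (squeeze_zero' (Eventually.of_forall fun _ => dist_nonneg) ?_ he)
    filter_upwards [hp] with i hi using (hz i hi).2
  exact N.isCompact_carrier.isClosed.mem_of_tendsto hlim (hp.mono fun i hi => (hz i hi).1)

lemma exists_tendsto_of_mem_thickened [Finite V] {ι : Type*} {L : Ultrafilter ι} {e : ι → ℝ}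
    (he : Tendsto e L (𝓝 0)) {p : ι → Space3} (hp : ∀ᶠ i in L, p i ∈ N.thickened (e i)) :
    ∃ x ∈ N.carrier, Tendsto p L (𝓝 x) := by
  have hmem : ∀ᶠ i in L, p i ∈ N.thickened 1 := by
    filter_upwards [hp, he.eventually_le_const zero_lt_one] with i hi hei
    exact N.thickened_mono hei hi
  obtain ⟨x, -, hx⟩ := (N.isCompact_thickened 1).ultrafilter_le_nhds' (L.map p) hmem
  exact ⟨x, N.mem_carrier_of_tendsto he hp hx, hx⟩

/-- Lower semicontinuity: curves of bounded action in shrinking neighbourhoods of the network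
have, in the limit, at least the action needed inside the network. -/
lemma eventually_sq_le_action [Finite V] {ι : Type*} {L : Ultrafilter ι} {e : ι → ℝ}
    (he : Tendsto e L (𝓝 0)) {γ : ι → ℝ → Space3} {A : NNReal}
    (hγ : ∀ᶠ i in L, IsPiecewiseC1 (γ i)) (hA : ∀ᶠ i in L, action (N.thickened (e i)) (γ i) ≤ A)
    {x y : Space3} (hx : Tendsto (fun i => γ i 0) L (𝓝 x)) (hy : Tendsto (fun i => γ i 1) L (𝓝 y))
    {v : ℝ≥0∞} (hv : v < geoDist N.carrier x y) :
    ∀ᶠ i in L, v ^ 2 ≤ action (N.thickened (e i)) (γ i) := by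
  have hmem : ∀ t ∈ Set.Icc (0 : ℝ) 1, ∀ᶠ i in L, γ i t ∈ N.thickened (e i) := fun t ht => by
    filter_upwards [hγ, hA] with i h1 h2
    exact mem_of_action_ne_top (N.isCompact_thickened _).isClosed h1
      (ne_top_of_le_ne_top ENNReal.coe_ne_top h2) ht
  -- Along an ultrafilter, compactness gives a limit at every time at once, so no subsequence is
  -- extracted. The uniform Hölder bound then makes the limit curve `g` continuous.
  have hlim : ∀ t, ∃ p, t ∈ Set.Icc (0 : ℝ) 1 →
      p ∈ N.carrier ∧ Tendsto (fun i => γ i t) L (𝓝 p) := fun t => by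
    by_cases ht : t ∈ Set.Icc (0 : ℝ) 1
    · obtain ⟨p, hp, hpl⟩ := N.exists_tendsto_of_mem_thickened he (hmem t ht)
      exact ⟨p, fun _ => ⟨hp, hpl⟩⟩
    · exact ⟨0, fun h => absurd h ht⟩
  choose g hg using hlim
  have hle : ∀ a b : ℝ, 0 ≤ a → a ≤ b → b ≤ 1 → dist (g b) (g a) ^ 2 ≤ |b - a| * A := by
    intro a b ha hab hb
    have hta := (hg a ⟨ha, hab.trans hb⟩).2
    have htb := (hg b ⟨ha.trans hab, hb⟩).2
    refine le_of_tendsto ((htb.dist hta).pow 2) ?_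
    filter_upwards [hγ, hA] with i h1 h2
    have h := edist_sq_le_action h1 (ne_top_of_le_ne_top ENNReal.coe_ne_top h2) ha hab hb
    have h' := h.trans (mul_le_mul_right h2 _)
    rw [edist_dist, ← ENNReal.ofReal_pow dist_nonneg, ← ENNReal.ofReal_coe_nnreal,
      ← ENNReal.ofReal_mul (by linarith), ENNReal.ofReal_le_ofReal_iff (by
        have := A.2; exact mul_nonneg (by linarith) this)] at h'
    rwa [abs_of_nonneg (by linarith)]
  have hle' : ∀ a ∈ Set.Icc (0 : ℝ) 1, ∀ b ∈ Set.Icc (0 : ℝ) 1,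
      dist (g b) (g a) ≤ √(|b - a| * A) := by
    intro a ha b hb
    refine Real.le_sqrt_of_sq_le ?_
    rcases le_total a b with hab | hab
    · exact hle a b ha.1 hab hb.2
    · rw [dist_comm, abs_sub_comm]
      exact hle b a hb.1 hab ha.2
  have hgc : ContinuousOn g (Set.Icc 0 1) := by
    intro a ha
    rw [ContinuousWithinAt, tendsto_iff_dist_tendsto_zero]
    have h0 : Tendsto (fun b : ℝ => √(|b - a| * A)) (𝓝[Set.Icc 0 1] a) (𝓝 0) := by
      have : Continuous fun b : ℝ => √(|b - a| * A) := by fun_prop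
      simpa using (this.tendsto a).mono_left nhdsWithin_le_nhds
    refine squeeze_zero' (Eventually.of_forall fun _ => dist_nonneg) ?_ h0
    filter_upwards [self_mem_nhdsWithin] with b hb using hle' a ha b hb
  have h01 : (0 : ℝ) ∈ Set.Icc (0 : ℝ) 1 := ⟨le_rfl, zero_le_one⟩
  have h11 : (1 : ℝ) ∈ Set.Icc (0 : ℝ) 1 := ⟨zero_le_one, le_rfl⟩
  have hvar := N.geoDist_le_eVariationOn hgc fun t ht => (hg t ht).1
  rw [tendsto_nhds_unique (hg 0 h01).2 hx, tendsto_nhds_unique (hg 1 h11).2 hy] at hvar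
  -- Variation is lower semicontinuous under pointwise convergence.
  filter_upwards [hγ, hA, eVariationOn.lowerSemicontinuous_aux (p := (L : Filter ι))
    (fun t ht => (hg t ht).2) (hv.trans_le hvar)] with i h1 h2 h3
  exact (pow_le_pow_left' h3.le 2).trans
    (eVariationOn_sq_le_action h1 (ne_top_of_le_ne_top ENNReal.coe_ne_top h2))

lemma exists_ultrafilter_of_frequently {ι : Type*} {L : Filter ι} {p : ι → Prop}
    (h : ∃ᶠ i in L, p i) : ∃ U : Ultrafilter ι, (U : Filter ι) ≤ L ∧ ∀ᶠ i in (U : Filter ι), p i := by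
  have : (L ⊓ 𝓟 {i | p i}).NeBot := inf_principal_neBot_iff.2 fun s hs => by
    obtain ⟨i, hi, hs⟩ := (h.and_eventually hs).exists
    exact ⟨i, hs, hi⟩
  exact ⟨Ultrafilter.of _, (Ultrafilter.of_le _).trans inf_le_left,
    (Ultrafilter.of_le _).trans inf_le_right (mem_principal_self _)⟩

/-! ### Uniform comparison of the costs with the extension `F` -/

variable {F : BoundedContinuousFunction (Space3 × Space3) NNReal}

/-- Otherwise there are curves along an ultrafilter whose action plus `δ` stays below `F` at their
end points. As `F` is bounded, so are the actions, and lower semicontinuity contradicts `δ ≠ 0` in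
the limit. -/
lemma eventually_le_cost_add [Finite V]
    (hF : ∀ x ∈ N.carrier, ∀ y ∈ N.carrier, (F (x, y) : ℝ≥0∞) = geoDist N.carrier x y ^ 2)
    {δ : ℝ≥0∞} (hδ : δ ≠ 0) :
    ∀ᶠ ε in 𝓝 (0 : ℝ), ∀ x ∈ N.thickened ε, ∀ y ∈ N.thickened ε,
      (F (x, y) : ℝ≥0∞) ≤ N.cost ε x y + δ := by
  by_contra hcon
  obtain ⟨L, hL, hP⟩ := exists_ultrafilter_of_frequently (not_eventually.1 hcon)
  have hex : ∀ ε, ∃ γ : ℝ → Space3, (¬ ∀ x ∈ N.thickened ε, ∀ y ∈ N.thickened ε,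
      (F (x, y) : ℝ≥0∞) ≤ N.cost ε x y + δ) → IsPiecewiseC1 γ ∧ γ 0 ∈ N.thickened ε ∧
        γ 1 ∈ N.thickened ε ∧ action (N.thickened ε) γ + δ < F (γ 0, γ 1) := by
    intro ε
    by_cases h : ∀ x ∈ N.thickened ε, ∀ y ∈ N.thickened ε, (F (x, y) : ℝ≥0∞) ≤ N.cost ε x y + δ
    · exact ⟨0, fun h' => absurd h h'⟩
    push Not at h
    obtain ⟨x, hx, y, hy, hlt⟩ := h
    rw [← lt_tsub_iff_right] at hlt
    obtain ⟨γ, hγ, ha⟩ : ∃ γ ∈ curves x y, action (N.thickened ε) γ < F (x, y) - δ := by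
      simpa [cost, actionCost, iInf_lt_iff] using hlt
    obtain ⟨hγ1, rfl, rfl⟩ := hγ
    exact ⟨γ, fun _ => ⟨hγ1, hx, hy, lt_tsub_iff_right.1 ha⟩⟩
  choose γ hγ using hex
  have hev := hP.mono hγ
  have he : Tendsto (fun ε : ℝ => ε) L (𝓝 0) := hL
  obtain ⟨x, hx, hxl⟩ := N.exists_tendsto_of_mem_thickened he (hev.mono fun ε h => h.2.1)
  obtain ⟨y, hy, hyl⟩ := N.exists_tendsto_of_mem_thickened he (hev.mono fun ε h => h.2.2.1)
  have hFl : Tendsto (fun ε => (F (γ ε 0, γ ε 1) : ℝ≥0∞)) L (𝓝 (F (x, y))) :=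
    ENNReal.tendsto_coe.2 ((F.continuous.tendsto (x, y)).comp (hxl.prodMk_nhds hyl))
  have hδF : δ ≤ F (x, y) :=
    ge_of_tendsto hFl (hev.mono fun ε h => le_add_self.trans h.2.2.2.le)
  have hFne : (F (x, y) : ℝ≥0∞) ≠ ⊤ := ENNReal.coe_ne_top
  have hlt : (F (x, y) : ℝ≥0∞) - δ < F (x, y) :=
    ENNReal.sub_lt_self hFne (fun h => hδ (by simpa [h] using hδF)) hδ
  refine hlt.not_ge ?_
  rw [hF x hx y hy]
  -- Every `v` below the limiting distance satisfies `v² + δ ≤ F (x, y)`; letting `v` increase to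
  -- that distance gives the impossible inequality.
  have : geoDist N.carrier x y ≤ (geoDist N.carrier x y ^ 2 - δ) ^ (1 / 2 : ℝ) := by
    refine le_of_forall_lt_imp_le_of_dense fun v hv => ?_
    have hvA := N.eventually_sq_le_action (A := nndist F 0) he (hev.mono fun ε h => h.1)
      (hev.mono fun ε h => (le_self_add.trans h.2.2.2.le).trans
        (ENNReal.coe_le_coe.2 (BoundedContinuousFunction.NNReal.upper_bound F _))) hxl hyl hv
    have hv2 : v ^ 2 + δ ≤ geoDist N.carrier x y ^ 2 := by
      rw [← hF x hx y hy]
      refine ge_of_tendsto hFl ?_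
      filter_upwards [hvA, hev] with ε h1 h2
      exact (add_le_add_left h1 δ).trans h2.2.2.2.le
    have hδt : δ ≠ ⊤ := ne_top_of_le_ne_top hFne hδF
    calc v = (v ^ 2) ^ (1 / 2 : ℝ) := by
          rw [← ENNReal.rpow_natCast, ← ENNReal.rpow_mul]; norm_num
      _ ≤ _ := by
          gcongr
          exact ENNReal.le_sub_of_add_le_right hδt hv2
  calc _ ≤ ((geoDist N.carrier x y ^ 2 - δ) ^ (1 / 2 : ℝ)) ^ 2 := pow_le_pow_left' this 2
    _ = _ := by rw [← ENNReal.rpow_natCast, ← ENNReal.rpow_mul]; norm_num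

/-- Travel straight to the network, along it, and straight back out. Bad pairs and their foot points
on the network have the same limits along an ultrafilter, where the estimate becomes `F (a, b) + δ ≤
F (a, b)`. -/
lemma eventually_cost_le_add [Finite V]
    (hF : ∀ x ∈ N.carrier, ∀ y ∈ N.carrier, (F (x, y) : ℝ≥0∞) = geoDist N.carrier x y ^ 2)
    {δ : ℝ≥0∞} (hδ : δ ≠ 0) :
    ∀ᶠ ε in 𝓝[>] (0 : ℝ), ∀ x ∈ N.thickened ε, ∀ y ∈ N.thickened ε,
      N.cost ε x y ≤ F (x, y) + δ := by
  by_contra hcon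
  obtain ⟨L, hL, hP⟩ := exists_ultrafilter_of_frequently (not_eventually.1 hcon)
  have hex : ∀ ε, ∃ x y x' y' : Space3, (¬ ∀ x ∈ N.thickened ε, ∀ y ∈ N.thickened ε,
      N.cost ε x y ≤ F (x, y) + δ) → 0 < ε → x ∈ N.thickened ε ∧ y ∈ N.thickened ε ∧
        x' ∈ N.carrier ∧ y' ∈ N.carrier ∧ dist x x' ≤ ε ∧ dist y y' ≤ ε ∧
        F (x, y) + δ ≤ (ENNReal.ofReal ε + ((F (x', y') : ℝ≥0∞) ^ (1 / 2 : ℝ) +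
          ENNReal.ofReal ε)) ^ 2 := by
    intro ε
    by_cases h : ∀ x ∈ N.thickened ε, ∀ y ∈ N.thickened ε, N.cost ε x y ≤ F (x, y) + δ
    · exact ⟨0, 0, 0, 0, fun h' => absurd h h'⟩
    push Not at h
    obtain ⟨x, hx, y, hy, hlt⟩ := h
    obtain ⟨x', hx', hxd, hxs⟩ := N.exists_mem_carrier_segment_subset hx
    obtain ⟨y', hy', hyd, hys⟩ := N.exists_mem_carrier_segment_subset hy
    refine ⟨x, y, x', y', fun _ hε => ⟨hx, hy, hx', hy', hxd, hyd, hlt.le.trans ?_⟩⟩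
    refine geoDist_le_iff.1 ((geoDist_triangle _ x x' y).trans (add_le_add ?_
      ((geoDist_triangle _ x' y' y).trans (add_le_add ?_ ?_))))
    · refine (geoDist_le_edist hxs).trans ?_
      rw [edist_dist]
      exact ENNReal.ofReal_le_ofReal hxd
    · rw [hF x' hx' y' hy', ← ENNReal.rpow_natCast, ← ENNReal.rpow_mul]
      norm_num
      exact geoDist_anti (N.carrier_subset_thickened hε.le) x' y'
    · refine (geoDist_le_edist (segment_symm ℝ y y' ▸ hys)).trans ?_
      rw [edist_comm, edist_dist]
      exact ENNReal.ofReal_le_ofReal hyd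
  choose x y x' y' h using hex
  have hev := (hP.and (hL self_mem_nhdsWithin)).mono fun ε hε => h ε hε.1 hε.2
  have he : Tendsto (fun ε : ℝ => ε) L (𝓝 0) := hL.trans nhdsWithin_le_nhds
  obtain ⟨a, ha, hal⟩ := N.exists_tendsto_of_mem_thickened he (hev.mono fun ε h => h.1)
  obtain ⟨b, hb, hbl⟩ := N.exists_tendsto_of_mem_thickened he (hev.mono fun ε h => h.2.1)
  have hal' : Tendsto x' L (𝓝 a) := hal.congr_dist (squeeze_zero'
    (Eventually.of_forall fun _ => dist_nonneg) (hev.mono fun ε h => h.2.2.2.2.1) he)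
  have hbl' : Tendsto y' L (𝓝 b) := hbl.congr_dist (squeeze_zero'
    (Eventually.of_forall fun _ => dist_nonneg) (hev.mono fun ε h => h.2.2.2.2.2.1) he)
  have hl1 : Tendsto (fun ε => (F (x ε, y ε) : ℝ≥0∞) + δ) L (𝓝 (F (a, b) + δ)) :=
    (ENNReal.tendsto_coe.2 ((F.continuous.tendsto (a, b)).comp (hal.prodMk_nhds hbl))).add_const δ
  have hl2 : Tendsto (fun ε => (F (x' ε, y' ε) : ℝ≥0∞)) L (𝓝 (F (a, b))) :=
    ENNReal.tendsto_coe.2 ((F.continuous.tendsto (a, b)).comp (hal'.prodMk_nhds hbl'))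
  have he0 : Tendsto (fun ε => ENNReal.ofReal ε) L (𝓝 0) := by
    simpa using ENNReal.tendsto_ofReal he
  have hl3 := ENNReal.Tendsto.pow (n := 2) (he0.add
    (((ENNReal.continuous_rpow_const (y := (1 / 2 : ℝ))).tendsto _ |>.comp hl2).add he0))
  have hle := le_of_tendsto_of_tendsto hl1 hl3 (hev.mono fun ε h => h.2.2.2.2.2.2)
  rw [zero_add, add_zero, ← ENNReal.rpow_natCast, ← ENNReal.rpow_mul] at hle
  norm_num at hle
  have hFne : (F (a, b) : ℝ≥0∞) ≠ ⊤ := ENNReal.coe_ne_top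
  exact hle.not_gt (ENNReal.lt_add_right hFne hδ)

end EmbeddedMetricGraph

/-! ### Building couplings with prescribed marginals -/

section Couplings

variable {X Y : Type*} [MeasurableSpace X] [MeasurableSpace Y]

/-- When `c = 0` the measure vanishes and absorbs the factor `⊤`. -/
lemma inv_smul_smul_of_measure_univ_eq {α : Measure X} {c : ℝ≥0∞} (h : α Set.univ = c)
    (hc : c ≤ 1) : c⁻¹ • c • α = α := by
  by_cases h0 : c = 0
  · rw [h0, Measure.measure_univ_eq_zero] at h
    simp [h]
  · rw [smul_smul, ENNReal.inv_mul_cancel h0 (ne_top_of_le_ne_top ENNReal.one_ne_top hc), one_smul]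

/-- A subcoupling can be completed to a coupling. -/
lemma exists_add_fst_snd_eq {μ : Measure X} {ν : Measure Y} [IsProbabilityMeasure μ]
    [IsProbabilityMeasure ν] {ρ : Measure (X × Y)} (h₁ : ρ.fst ≤ μ) (h₂ : ρ.snd ≤ ν) :
    ∃ r : Measure (X × Y), (ρ + r).fst = μ ∧ (ρ + r).snd = ν := by
  have : IsFiniteMeasure ρ.fst := isFiniteMeasure_of_le μ h₁
  have : IsFiniteMeasure ρ.snd := isFiniteMeasure_of_le ν h₂
  have hα : (μ - ρ.fst) Set.univ = 1 - ρ Set.univ := by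
    rw [Measure.sub_apply MeasurableSet.univ h₁, Measure.fst_univ, measure_univ]
  have hβ : (ν - ρ.snd) Set.univ = 1 - ρ Set.univ := by
    rw [Measure.sub_apply MeasurableSet.univ h₂, Measure.snd_univ, measure_univ]
  -- The two residual marginals have equal mass; their product divided by that mass couples them.
  refine ⟨(1 - ρ Set.univ)⁻¹ • (μ - ρ.fst).prod (ν - ρ.snd), ?_, ?_⟩
  · rw [Measure.fst, Measure.map_add _ _ measurable_fst, Measure.map_smul, Measure.map_fst_prod, hβ,
      inv_smul_smul_of_measure_univ_eq hα tsub_le_self, ← Measure.fst, add_comm, Measure.sub_add_cancel_of_le h₁]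
  · rw [Measure.snd, Measure.map_add _ _ measurable_snd, Measure.map_smul, Measure.map_snd_prod, hα,
      inv_smul_smul_of_measure_univ_eq hβ tsub_le_self, ← Measure.snd, add_comm, Measure.sub_add_cancel_of_le h₂]

lemma fst_withDensity_prod_le {μ : Measure X} {ν : Measure Y} [SFinite μ] [SFinite ν]
    {h : X × Y → ℝ≥0∞} (hh : Measurable h) (hle : ∀ᵐ x ∂μ, ∫⁻ y, h (x, y) ∂ν ≤ 1) :
    ((μ.prod ν).withDensity h).fst ≤ μ := by
  refine Measure.le_iff.2 fun s hs => ?_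
  rw [Measure.fst_apply hs, withDensity_apply _ (measurable_fst hs),
    show Prod.fst ⁻¹' s = s ×ˢ (Set.univ : Set Y) by ext; simp, ← Measure.prod_restrict,
    lintegral_prod _ hh.aemeasurable, Measure.restrict_univ]
  calc ∫⁻ x in s, ∫⁻ y, h (x, y) ∂ν ∂μ ≤ ∫⁻ x in s, 1 ∂μ :=
        lintegral_mono_ae (ae_restrict_of_ae hle)
    _ = μ s := by simp

lemma snd_withDensity_prod_le {μ : Measure X} {ν : Measure Y} [SFinite μ] [SFinite ν]
    {h : X × Y → ℝ≥0∞} (hh : Measurable h) (hle : ∀ᵐ y ∂ν, ∫⁻ x, h (x, y) ∂μ ≤ 1) :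
    ((μ.prod ν).withDensity h).snd ≤ ν := by
  refine Measure.le_iff.2 fun s hs => ?_
  rw [Measure.snd_apply hs, withDensity_apply _ (measurable_snd hs),
    show Prod.snd ⁻¹' s = (Set.univ : Set X) ×ˢ s by ext; simp, ← Measure.prod_restrict,
    lintegral_prod_symm _ hh.aemeasurable, Measure.restrict_univ]
  calc ∫⁻ y in s, ∫⁻ x, h (x, y) ∂μ ∂ν ≤ ∫⁻ y in s, 1 ∂ν :=
        lintegral_mono_ae (ae_restrict_of_ae hle)
    _ = ν s := by simp

/-- If `μ` and `ν` give to the members of two finite partitions of unity at least a fixed proportion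
`s` of the mass given to them by the marginals of `σ₀`, and if a cost `F` oscillates little on the
products of their supports, then `μ` and `ν` have a coupling that is not much more expensive
than `σ₀`. -/
lemma exists_coupling_lintegral_le {ι κ : Type*} [Fintype ι] [Fintype κ] {μ : Measure X}
    {ν : Measure Y} [IsProbabilityMeasure μ] [IsProbabilityMeasure ν] {σ₀ : Measure (X × Y)}
    [IsProbabilityMeasure σ₀] {p : ι → X → ℝ≥0∞} {q : κ → Y → ℝ≥0∞}
    (hp : ∀ i, Measurable (p i)) (hq : ∀ j, Measurable (q j))
    (hpμ : ∀ᵐ x ∂μ, ∑ i, p i x = 1) (hqν : ∀ᵐ y ∂ν, ∑ j, q j y = 1)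
    (hpσ : ∀ᵐ z ∂σ₀, ∑ i, p i z.1 = 1) (hqσ : ∀ᵐ z ∂σ₀, ∑ j, q j z.2 = 1)
    {s : ℝ≥0∞} (hs0 : s ≠ 0) (hs1 : s ≤ 1)
    (hsp : ∀ i, s * ∫⁻ z, p i z.1 ∂σ₀ ≤ ∫⁻ x, p i x ∂μ)
    (hsq : ∀ j, s * ∫⁻ z, q j z.2 ∂σ₀ ≤ ∫⁻ y, q j y ∂ν)
    {F : X × Y → ℝ≥0∞} (hF : Measurable F) {C δ : ℝ≥0∞} (hC : ∀ z, F z ≤ C) {M : ι → κ → ℝ≥0∞}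
    (hM : ∀ᵐ z ∂(μ.prod ν), ∀ i j, p i z.1 ≠ 0 → q j z.2 ≠ 0 → F z ≤ M i j)
    (hMσ : ∀ᵐ z ∂σ₀, ∀ i j, p i z.1 ≠ 0 → q j z.2 ≠ 0 → M i j ≤ F z + δ) :
    ∃ σ : Measure (X × Y), σ.fst = μ ∧ σ.snd = ν ∧
      ∫⁻ z, F z ∂σ ≤ ∫⁻ z, F z ∂σ₀ + δ + C * (1 - s) := by
  set a : ι → ℝ≥0∞ := fun i => ∫⁻ x, p i x ∂μ with ha
  set b : κ → ℝ≥0∞ := fun j => ∫⁻ y, q j y ∂ν with hb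
  set w : ι → κ → ℝ≥0∞ := fun i j => ∫⁻ z, p i z.1 * q j z.2 ∂σ₀ with hw
  -- The density `h` gives the cell `(i, j)` the mass `s * w i j`, where `w i j` is its mass under
  -- `σ₀`; within the cell it is a multiple of a product measure.
  set k : ι → κ → ℝ≥0∞ := fun i j => s * w i j * (a i)⁻¹ * (b j)⁻¹ with hk
  set h : X × Y → ℝ≥0∞ := fun z => ∑ i, ∑ j, k i j * (p i z.1 * q j z.2) with hh
  have hpm : ∀ i, Measurable fun z : X × Y => p i z.1 := fun i => (hp i).comp measurable_fst
  have hqm : ∀ j, Measurable fun z : X × Y => q j z.2 := fun j => (hq j).comp measurable_snd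
  have hpq : ∀ i j, Measurable fun z : X × Y => p i z.1 * q j z.2 :=
    fun i j => (hpm i).mul (hqm j)
  have hkpq : ∀ i j, Measurable fun z : X × Y => k i j * (p i z.1 * q j z.2) :=
    fun i j => (hpq i j).const_mul _
  have hhm : Measurable h :=
    Finset.measurable_fun_sum _ fun i _ => Finset.measurable_fun_sum _ fun j _ => hkpq i j
  have hwp : ∀ i, ∑ j, w i j = ∫⁻ z, p i z.1 ∂σ₀ := fun i => by
    rw [hw, ← lintegral_finsetSum _ fun j _ => hpq i j]
    refine lintegral_congr_ae (hqσ.mono fun z hz => ?_)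
    simp only [← Finset.mul_sum, hz, mul_one]
  have hwq : ∀ j, ∑ i, w i j = ∫⁻ z, q j z.2 ∂σ₀ := fun j => by
    rw [hw, ← lintegral_finsetSum _ fun i _ => hpq i j]
    refine lintegral_congr_ae (hpσ.mono fun z hz => ?_)
    simp only [← Finset.sum_mul, hz, one_mul]
  have ha_top : ∀ i, a i ≠ ⊤ := fun i => by
    refine ne_top_of_le_ne_top ENNReal.one_ne_top (?_ : a i ≤ 1)
    calc a i ≤ ∫⁻ _, 1 ∂μ := lintegral_mono_ae (hpμ.mono fun x hx => hx ▸
          Finset.single_le_sum (f := fun i => p i x) (fun _ _ => bot_le) (Finset.mem_univ i))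
      _ = 1 := by simp
  have hb_top : ∀ j, b j ≠ ⊤ := fun j => by
    refine ne_top_of_le_ne_top ENNReal.one_ne_top (?_ : b j ≤ 1)
    calc b j ≤ ∫⁻ _, 1 ∂ν := lintegral_mono_ae (hqν.mono fun y hy => hy ▸
          Finset.single_le_sum (f := fun j => q j y) (fun _ _ => bot_le) (Finset.mem_univ j))
      _ = 1 := by simp
  -- If `a i` or `b j` vanishes, the mass hypotheses and `s ≠ 0` force `w i j = 0`, so the infinite
  -- inverse is harmless.
  have hkab : ∀ i j, k i j * (a i * b j) = s * w i j := by
    intro i j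
    by_cases ha0 : a i = 0
    · have h0 : ∑ j, w i j = 0 := by
        have h' := hsp i
        rw [← hwp, show ∫⁻ x, p i x ∂μ = 0 from ha0, nonpos_iff_eq_zero] at h'
        exact (mul_eq_zero.1 h').resolve_left hs0
      have : w i j = 0 := (Finset.sum_eq_zero_iff.1 h0) j (Finset.mem_univ j)
      simp [hk, this]
    by_cases hb0 : b j = 0
    · have h0 : ∑ i, w i j = 0 := by
        have h' := hsq j
        rw [← hwq, show ∫⁻ y, q j y ∂ν = 0 from hb0, nonpos_iff_eq_zero] at h'
        exact (mul_eq_zero.1 h').resolve_left hs0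
      have : w i j = 0 := (Finset.sum_eq_zero_iff.1 h0) i (Finset.mem_univ i)
      simp [hk, this]
    calc k i j * (a i * b j) = s * w i j * ((a i)⁻¹ * a i) * ((b j)⁻¹ * b j) := by
          simp only [hk]; ring
      _ = _ := by
          rw [ENNReal.inv_mul_cancel ha0 (ha_top i), ENNReal.inv_mul_cancel hb0 (hb_top j), mul_one,
            mul_one]
  have hint : ∀ i j, ∫⁻ z, p i z.1 * q j z.2 ∂(μ.prod ν) = a i * b j := fun i j =>
    lintegral_prod_mul (hp i).aemeasurable (hq j).aemeasurable
  have hmass : (μ.prod ν).withDensity h Set.univ = s := by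
    rw [withDensity_apply _ MeasurableSet.univ, Measure.restrict_univ, hh,
      lintegral_finsetSum _ fun i _ => Finset.measurable_fun_sum _ fun j _ => hkpq i j]
    calc _ = ∑ i, ∑ j, s * w i j := by
          refine Finset.sum_congr rfl fun i _ => ?_
          rw [lintegral_finsetSum _ fun j _ => hkpq i j]
          refine Finset.sum_congr rfl fun j _ => ?_
          rw [lintegral_const_mul _ (hpq i j), hint, hkab]
      _ = s * ∑ i, ∫⁻ z, p i z.1 ∂σ₀ := by simp only [← Finset.mul_sum, hwp]
      _ = s := by
          rw [← lintegral_finsetSum _ fun i _ => hpm i, lintegral_congr_ae hpσ]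
          simp
  have hfst : ((μ.prod ν).withDensity h).fst ≤ μ := by
    refine fst_withDensity_prod_le hhm (hpμ.mono fun x hx => ?_)
    simp only [hh]
    rw [lintegral_finsetSum _ fun i _ => Finset.measurable_fun_sum _ fun j _ =>
      ((hq j).const_mul _).const_mul _, ← hx]
    refine Finset.sum_le_sum fun i _ => ?_
    rw [lintegral_finsetSum _ fun j _ => ((hq j).const_mul _).const_mul _]
    calc _ = ∑ j, s * w i j * (a i)⁻¹ * p i x * ((b j)⁻¹ * b j) := by
          refine Finset.sum_congr rfl fun j _ => ?_
          rw [lintegral_const_mul _ ((hq j).const_mul _), lintegral_const_mul _ (hq j)]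
          simp only [hk, hb]
          ring
      _ ≤ ∑ j, s * w i j * (a i)⁻¹ * p i x * 1 := by
          gcongr with j
          exact ENNReal.inv_mul_le_one _
      _ = (s * ∫⁻ z, p i z.1 ∂σ₀) * (a i)⁻¹ * p i x := by
          simp only [mul_one, ← Finset.sum_mul, ← Finset.mul_sum, hwp]
      _ ≤ a i * (a i)⁻¹ * p i x := by
          gcongr
          exact hsp i
      _ ≤ 1 * p i x := by
          gcongr
          exact ENNReal.mul_inv_le_one _
      _ = p i x := one_mul _
  have hsnd : ((μ.prod ν).withDensity h).snd ≤ ν := by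
    refine snd_withDensity_prod_le hhm (hqν.mono fun y hy => ?_)
    simp only [hh]
    rw [lintegral_finsetSum _ fun i _ => Finset.measurable_fun_sum _ fun j _ =>
      ((hp i).mul_const _).const_mul _, ← hy]
    calc _ = ∑ i, ∑ j, s * w i j * (b j)⁻¹ * q j y * ((a i)⁻¹ * a i) := by
          refine Finset.sum_congr rfl fun i _ => ?_
          rw [lintegral_finsetSum _ fun j _ => ((hp i).mul_const _).const_mul _]
          refine Finset.sum_congr rfl fun j _ => ?_
          rw [lintegral_const_mul _ ((hp i).mul_const _), lintegral_mul_const _ (hp i)]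
          simp only [hk, ha]
          ring
      _ ≤ ∑ i, ∑ j, s * w i j * (b j)⁻¹ * q j y * 1 := by
          gcongr with i _ j
          exact ENNReal.inv_mul_le_one _
      _ = ∑ j, (s * ∫⁻ z, q j z.2 ∂σ₀) * (b j)⁻¹ * q j y := by
          rw [Finset.sum_comm]
          simp only [mul_one, ← Finset.sum_mul, ← Finset.mul_sum, hwq]
      _ ≤ ∑ j, b j * (b j)⁻¹ * q j y := by
          gcongr with j
          exact hsq j
      _ ≤ ∑ j, 1 * q j y := by
          gcongr with j
          exact ENNReal.mul_inv_le_one _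
      _ = _ := by simp only [one_mul]
  have hcost : ∫⁻ z, F z ∂((μ.prod ν).withDensity h) ≤ ∫⁻ z, F z ∂σ₀ + δ := by
    rw [lintegral_withDensity_eq_lintegral_mul _ hhm hF]
    calc ∫⁻ z, (h * F) z ∂(μ.prod ν)
        ≤ ∫⁻ z, ∑ i, ∑ j, k i j * (p i z.1 * q j z.2) * M i j ∂(μ.prod ν) := by
          refine lintegral_mono_ae (hM.mono fun z hz => ?_)
          simp only [Pi.mul_apply, hh, Finset.sum_mul]
          refine Finset.sum_le_sum fun i _ => Finset.sum_le_sum fun j _ => ?_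
          by_cases hpz : p i z.1 = 0
          · simp [hpz]
          by_cases hqz : q j z.2 = 0
          · simp [hqz]
          gcongr
          exact hz i j hpz hqz
      _ = ∑ i, ∑ j, s * w i j * M i j := by
          rw [lintegral_finsetSum _ fun i _ => Finset.measurable_fun_sum _ fun j _ =>
            (hkpq i j).mul_const _]
          refine Finset.sum_congr rfl fun i _ => ?_
          rw [lintegral_finsetSum _ fun j _ => (hkpq i j).mul_const _]
          refine Finset.sum_congr rfl fun j _ => ?_
          rw [lintegral_mul_const _ (hkpq i j), lintegral_const_mul _ (hpq i j), hint, hkab]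
      _ ≤ ∑ i, ∑ j, w i j * M i j := by
          gcongr with i _ j
          calc s * w i j ≤ 1 * w i j := by gcongr
            _ = w i j := one_mul _
      _ = ∫⁻ z, ∑ i, ∑ j, p i z.1 * q j z.2 * M i j ∂σ₀ := by
          rw [lintegral_finsetSum _ fun i _ => Finset.measurable_fun_sum _ fun j _ =>
            (hpq i j).mul_const _]
          refine Finset.sum_congr rfl fun i _ => ?_
          rw [lintegral_finsetSum _ fun j _ => (hpq i j).mul_const _]
          refine Finset.sum_congr rfl fun j _ => ?_
          rw [lintegral_mul_const _ (hpq i j)]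
      _ ≤ ∫⁻ z, (F z + δ) ∂σ₀ := by
          refine lintegral_mono_ae ?_
          filter_upwards [hMσ, hpσ, hqσ] with z hz hz1 hz2
          calc _ ≤ ∑ i, ∑ j, p i z.1 * q j z.2 * (F z + δ) := by
                refine Finset.sum_le_sum fun i _ => Finset.sum_le_sum fun j _ => ?_
                by_cases hpz : p i z.1 = 0
                · simp [hpz]
                by_cases hqz : q j z.2 = 0
                · simp [hqz]
                gcongr
                exact hz i j hpz hqz
            _ = F z + δ := by
                simp only [← Finset.sum_mul, ← Finset.mul_sum, hz1, hz2, one_mul]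
      _ = _ := by rw [lintegral_add_left hF]; simp
  -- The remainder has mass `1 - s` and costs at most `C` per unit.
  obtain ⟨r, hr1, hr2⟩ := exists_add_fst_snd_eq hfst hsnd
  refine ⟨_, hr1, hr2, ?_⟩
  have hr : s + r Set.univ = 1 := by
    rw [← hmass, ← Measure.add_apply, ← Measure.fst_univ, hr1, measure_univ]
  have hr' : r Set.univ = 1 - s :=
    ENNReal.eq_sub_of_add_eq (ne_top_of_le_ne_top ENNReal.one_ne_top hs1) (by rw [add_comm, hr])
  rw [lintegral_add_measure]
  refine add_le_add hcost ?_
  calc ∫⁻ z, F z ∂r ≤ ∫⁻ _, C ∂r := lintegral_mono hC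
    _ = C * (1 - s) := by rw [lintegral_const, hr']

end Couplings

/-! ### Weak limits and approximation of couplings -/

lemma ae_fst_of_mem_couplings {μ ν : ProbabilityMeasure Space3}
    {σ : ProbabilityMeasure (Space3 × Space3)} (h : σ ∈ couplings μ ν) {P : Space3 → Prop}
    (hP : ∀ᵐ x ∂(μ : Measure Space3), P x) :
    ∀ᵐ z ∂(σ : Measure (Space3 × Space3)), P z.1 := by
  rw [← h.1] at hP
  exact ae_of_ae_map measurable_fst.aemeasurable hP

lemma ae_snd_of_mem_couplings {μ ν : ProbabilityMeasure Space3}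
    {σ : ProbabilityMeasure (Space3 × Space3)} (h : σ ∈ couplings μ ν) {P : Space3 → Prop}
    (hP : ∀ᵐ x ∂(ν : Measure Space3), P x) :
    ∀ᵐ z ∂(σ : Measure (Space3 × Space3)), P z.2 := by
  rw [← h.2] at hP
  exact ae_of_ae_map measurable_snd.aemeasurable hP

lemma ae_mem_of_support_subset {μ : Measure Space3} {S : Set Space3} (h : μ.support ⊆ S) :
    ∀ᵐ x ∂μ, x ∈ S :=
  mem_of_superset Measure.support_mem_ae h

/-- A compact set carries a finite continuous partition of unity by functions of small support. -/
lemma exists_small_partition_of_unity {K : Set Space3} (hK : IsCompact K) {r : ℝ} (hr : 0 < r) :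
    ∃ (n : ℕ) (c : Fin n → Space3) (p : Fin n → BoundedContinuousFunction Space3 NNReal),
      (∀ i, c i ∈ K) ∧ (∀ i x, p i x ≠ 0 → dist x (c i) < r) ∧
        ∀ x ∈ K, ∑ i, (p i x : ℝ≥0∞) = 1 := by
  obtain ⟨t, htK, htf, hcov⟩ := hK.finite_cover_balls hr
  have : Fintype t := htf.fintype
  set e := Fintype.equivFin t
  set c : Fin (Fintype.card t) → Space3 := fun i => (e.symm i : Space3)
  obtain ⟨f, hfs, hf1, hf01, -⟩ := exists_continuous_sum_one_of_isOpen_isCompact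
    (s := fun i => Metric.ball (c i) r) (fun i => Metric.isOpen_ball) hK (by
      refine hcov.trans fun x hx => ?_
      obtain ⟨y, hy, hxy⟩ := Set.mem_iUnion₂.1 hx
      exact Set.mem_iUnion.2 ⟨e ⟨y, hy⟩, by simpa [c] using hxy⟩)
  set g : Fin (Fintype.card t) → BoundedContinuousFunction Space3 ℝ := fun i =>
    BoundedContinuousFunction.ofNormedAddCommGroup (f i) (f i).continuous 1 fun x => by
      rw [Real.norm_eq_abs, abs_of_nonneg (hf01 i x).1]
      exact (hf01 i x).2
  have hg : ∀ i x, (((g i).nnrealPart x : NNReal) : ℝ≥0∞) = ENNReal.ofReal (f i x) :=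
    fun i x => rfl
  refine ⟨_, c, fun i => (g i).nnrealPart, fun i => htK (e.symm i).2, fun i x hx => ?_,
    fun x hx => ?_⟩
  · have hx' : f i x ≠ 0 := fun h => hx (by
      have := hg i x
      rw [h, ENNReal.ofReal_zero, ENNReal.coe_eq_zero] at this
      exact this)
    exact hfs i (subset_tsupport _ hx')
  · simp only [hg]
    rw [← ENNReal.ofReal_sum_of_nonneg fun i _ => (hf01 i x).1]
    have := hf1 hx
    simp only [Finset.sum_apply, Pi.one_apply] at this
    rw [this, ENNReal.ofReal_one]

/-- Couplings of weak limits can be approximated by couplings, with respect to the transport cost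
of a bounded continuous function. -/
lemma eventually_exists_coupling_lintegral_le {ι : Type*} {L : Filter ι} {K : Set Space3}
    (hK : IsCompact K) {μ ν : ι → ProbabilityMeasure Space3} {μ₀ ν₀ : ProbabilityMeasure Space3}
    (hμ : Tendsto μ L (𝓝 μ₀)) (hν : Tendsto ν L (𝓝 ν₀))
    (hμK : ∀ᶠ i in L, ∀ᵐ x ∂(μ i : Measure Space3), x ∈ K)
    (hνK : ∀ᶠ i in L, ∀ᵐ x ∂(ν i : Measure Space3), x ∈ K)
    (hμ₀K : ∀ᵐ x ∂(μ₀ : Measure Space3), x ∈ K) (hν₀K : ∀ᵐ x ∂(ν₀ : Measure Space3), x ∈ K)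
    (F : BoundedContinuousFunction (Space3 × Space3) NNReal)
    {σ₀ : ProbabilityMeasure (Space3 × Space3)} (hσ₀ : σ₀ ∈ couplings μ₀ ν₀)
    {δ : NNReal} (hδ : 0 < δ) :
    ∀ᶠ i in L, ∃ σ ∈ couplings (μ i) (ν i),
      ∫⁻ z, F z ∂(σ : Measure (Space3 × Space3)) ≤
        ∫⁻ z, F z ∂(σ₀ : Measure (Space3 × Space3)) + δ + δ := by
  have hδ2 : (0 : ℝ) < δ / 2 := by positivity
  obtain ⟨r, hr, hunif⟩ := Metric.uniformContinuousOn_iff.1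
    ((hK.prod hK).uniformContinuousOn_of_continuous F.continuous.continuousOn) (δ / 2) hδ2
  obtain ⟨n, c, p, hc, hpr, hp1⟩ := exists_small_partition_of_unity hK hr
  have hbound : ∀ z ∈ K ×ˢ K, ∀ i j, (p i z.1 : ℝ≥0∞) ≠ 0 → (p j z.2 : ℝ≥0∞) ≠ 0 →
      (F z : ℝ≥0∞) ≤ F (c i, c j) + ((δ / 2 : NNReal) : ℝ≥0∞) ∧
        F (c i, c j) + ((δ / 2 : NNReal) : ℝ≥0∞) ≤ F z + δ := by
    intro z hz i j hi hj
    have hd := hunif z hz (c i, c j) ⟨hc i, hc j⟩ (max_lt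
      (hpr i z.1 (by simpa using hi)) (hpr j z.2 (by simpa using hj)))
    rw [NNReal.dist_eq, abs_lt] at hd
    norm_cast
    constructor
    · rw [← NNReal.coe_le_coe]
      push_cast
      linarith [hd.2]
    · rw [← NNReal.coe_le_coe]
      push_cast
      linarith [hd.1]
  obtain ⟨t₀, ht₀, htC⟩ := ENNReal.exists_nnreal_pos_mul_lt
    (a := (nndist F 0 : ℝ≥0∞)) (b := δ) ENNReal.coe_ne_top (by simpa using hδ.ne')
  -- The transported proportion is `s = 1 - t`: the choice of `t₀` makes the remainder cost less
  -- than `δ`, and the bound `1 / 2` keeps `s` positive.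
  set t : NNReal := min t₀ (1 / 2) with ht
  have ht0 : 0 < t := lt_min ht₀ (by norm_num)
  have ht1 : t < 1 := (min_le_right _ _).trans_lt (by rw [← NNReal.coe_lt_coe]; norm_num)
  have hts : (1 : ℝ≥0∞) - (1 - t) = t :=
    ENNReal.sub_sub_cancel ENNReal.one_ne_top (by exact_mod_cast ht1.le)
  have hs1 : (1 - t : ℝ≥0∞) < 1 :=
    ENNReal.sub_lt_self ENNReal.one_ne_top one_ne_zero (by simpa using ht0.ne')
  have hs0 : (1 - t : ℝ≥0∞) ≠ 0 := (tsub_pos_of_lt (by exact_mod_cast ht1)).ne'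
  -- Only finitely many integrals are involved. The strict loss `1 - t < 1` turns their convergence
  -- into eventual inequalities, and zero limits are trivial.
  have hprop : ∀ {θ : ι → ProbabilityMeasure Space3} {θ₀ : ProbabilityMeasure Space3},
      Tendsto θ L (𝓝 θ₀) → ∀ᶠ i in L, ∀ j, (1 - t : ℝ≥0∞) * ∫⁻ x, p j x ∂(θ₀ : Measure Space3) ≤
        ∫⁻ x, p j x ∂(θ i : Measure Space3) := by
    intro θ θ₀ hθ
    refine eventually_all.2 fun j => ?_
    have hlim := ProbabilityMeasure.tendsto_iff_forall_lintegral_tendsto.1 hθ (p j)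
    by_cases h0 : ∫⁻ x, p j x ∂(θ₀ : Measure Space3) = 0
    · simp [h0]
    · have htop : ∫⁻ x, p j x ∂(θ₀ : Measure Space3) ≠ ⊤ :=
        ((p j).lintegral_lt_top_of_nnreal _).ne
      refine (hlim.eventually_const_lt ?_).mono fun i hi => le_of_lt hi
      calc _ < 1 * ∫⁻ x, p j x ∂(θ₀ : Measure Space3) :=
            ENNReal.mul_lt_mul_left h0 htop hs1
        _ = _ := one_mul _
  have hpm : ∀ j, Measurable fun x => (p j x : ℝ≥0∞) := fun j =>
    (p j).continuous.measurable.coe_nnreal_ennreal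
  have hK₀1 := ae_fst_of_mem_couplings hσ₀ hμ₀K
  have hK₀2 := ae_snd_of_mem_couplings hσ₀ hν₀K
  filter_upwards [hprop hμ, hprop hν, hμK, hνK] with i hi1 hi2 hi3 hi4
  have hm1 : ∀ j, ∫⁻ z, p j z.1 ∂(σ₀ : Measure (Space3 × Space3)) =
      ∫⁻ x, p j x ∂(μ₀ : Measure Space3) := fun j => by
    rw [← hσ₀.1, Measure.fst, lintegral_map (hpm j) measurable_fst]
  have hm2 : ∀ j, ∫⁻ z, p j z.2 ∂(σ₀ : Measure (Space3 × Space3)) =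
      ∫⁻ x, p j x ∂(ν₀ : Measure Space3) := fun j => by
    rw [← hσ₀.2, Measure.snd, lintegral_map (hpm j) measurable_snd]
  have hprodK : ∀ᵐ z ∂((μ i : Measure Space3).prod (ν i : Measure Space3)), z ∈ K ×ˢ K := by
    filter_upwards [Measure.quasiMeasurePreserving_fst.ae hi3,
      Measure.quasiMeasurePreserving_snd.ae hi4] with z h1 h2 using ⟨h1, h2⟩
  obtain ⟨σ, hσ1, hσ2, hσ⟩ := exists_coupling_lintegral_le (μ := (μ i : Measure Space3))
    (ν := (ν i : Measure Space3)) (σ₀ := (σ₀ : Measure (Space3 × Space3)))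
    (p := fun j x => (p j x : ℝ≥0∞)) (q := fun j x => (p j x : ℝ≥0∞)) hpm hpm
    (hi3.mono hp1) (hi4.mono hp1) (hK₀1.mono fun z hz => hp1 _ hz) (hK₀2.mono fun z hz => hp1 _ hz)
    hs0 hs1.le (fun j => by rw [hm1]; exact hi1 j) (fun j => by rw [hm2]; exact hi2 j)
    (F := fun z => (F z : ℝ≥0∞)) F.continuous.measurable.coe_nnreal_ennreal
    (C := nndist F 0) (δ := δ)
    (fun z => ENNReal.coe_le_coe.2 (BoundedContinuousFunction.NNReal.upper_bound F z))
    (M := fun i j => F (c i, c j) + ((δ / 2 : NNReal) : ℝ≥0∞))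
    (hprodK.mono fun z hz i j hi hj => (hbound z hz i j hi hj).1)
    ((hK₀1.and hK₀2).mono fun z hz i j hi hj => (hbound z hz i j hi hj).2)
  have hσp : IsProbabilityMeasure σ := ⟨by rw [← Measure.fst_univ, hσ1, measure_univ]⟩
  refine ⟨⟨σ, hσp⟩, ⟨hσ1, hσ2⟩, hσ.trans (add_le_add le_rfl ?_)⟩
  rw [hts]
  refine le_trans ?_ htC.le
  rw [mul_comm]
  gcongr
  exact min_le_left _ _

lemma mem_couplings_of_tendsto {ι : Type*} {L : Filter ι} [L.NeBot]
    {μ ν : ι → ProbabilityMeasure Space3} {μ₀ ν₀ : ProbabilityMeasure Space3}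
    {π : ι → ProbabilityMeasure (Space3 × Space3)} {π₀ : ProbabilityMeasure (Space3 × Space3)}
    (hμ : Tendsto μ L (𝓝 μ₀)) (hν : Tendsto ν L (𝓝 ν₀)) (hπ₀ : Tendsto π L (𝓝 π₀))
    (hπ : ∀ᶠ i in L, π i ∈ couplings (μ i) (ν i)) : π₀ ∈ couplings μ₀ ν₀ := by
  have h1 := ProbabilityMeasure.tendsto_map_of_tendsto_of_continuous π π₀ hπ₀ continuous_fst
  have h2 := ProbabilityMeasure.tendsto_map_of_tendsto_of_continuous π π₀ hπ₀ continuous_snd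
  constructor
  · have h := tendsto_nhds_unique (h1.congr' (f₂ := μ)
      (hπ.mono fun i hi => Subtype.ext hi.1)) hμ
    exact congrArg Subtype.val h
  · have h := tendsto_nhds_unique (h2.congr' (f₂ := ν)
      (hπ.mono fun i hi => Subtype.ext hi.2)) hν
    exact congrArg Subtype.val h

/-! ### Convergence of optimal couplings -/

namespace EmbeddedMetricGraph

variable {V : Type*} [Finite V] (N : EmbeddedMetricGraph V)

/-- Limits of optimal couplings in shrinking neighbourhoods of the network are optimal in the
network. -/
theorem isOptimalCoupling_of_tendsto {ι : Type*} {L : Filter ι} [L.NeBot] {e : ι → ℝ}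
    (he : Tendsto e L (𝓝[>] 0)) {μ ν : ι → ProbabilityMeasure Space3}
    {μ₀ ν₀ : ProbabilityMeasure Space3}
    (hμ : ∀ᶠ i in L, (μ i : Measure Space3).support ⊆ N.thickened (e i))
    (hν : ∀ᶠ i in L, (ν i : Measure Space3).support ⊆ N.thickened (e i))
    (hμ₀ : (μ₀ : Measure Space3).support ⊆ N.carrier)
    (hν₀ : (ν₀ : Measure Space3).support ⊆ N.carrier)
    (hμlim : Tendsto μ L (𝓝 μ₀)) (hνlim : Tendsto ν L (𝓝 ν₀))
    {π : ι → ProbabilityMeasure (Space3 × Space3)} {π₀ : ProbabilityMeasure (Space3 × Space3)}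
    (hπ : ∀ᶠ i in L, IsOptimalCoupling (N.cost (e i)) (μ i) (ν i) (π i))
    (hlim : Tendsto π L (𝓝 π₀)) : IsOptimalCoupling (N.cost 0) μ₀ ν₀ π₀ := by
  obtain ⟨F, hF⟩ := N.exists_boundedContinuous_extension
  have hFm : Measurable fun z => (F z : ℝ≥0∞) := F.continuous.measurable.coe_nnreal_ennreal
  have hπ₀ : π₀ ∈ couplings μ₀ ν₀ :=
    mem_couplings_of_tendsto hμlim hνlim hlim (hπ.mono fun i hi => hi.1)
  have hcost0 : ∀ σ ∈ couplings μ₀ ν₀, transportCost (N.cost 0) σ =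
      ∫⁻ z, F z ∂(σ : Measure (Space3 × Space3)) := by
    intro σ hσ
    refine lintegral_congr_ae ?_
    filter_upwards [ae_fst_of_mem_couplings hσ (ae_mem_of_support_subset hμ₀),
      ae_snd_of_mem_couplings hσ (ae_mem_of_support_subset hν₀)] with z h1 h2
    rw [cost, thickened_zero, ← geoDist_sq, ← hF z.1 h1 z.2 h2]
  refine ⟨hπ₀, le_antisymm (le_iInf₂ fun σ₀ hσ₀ => ?_) (iInf₂_le π₀ hπ₀)⟩
  rw [hcost0 π₀ hπ₀, hcost0 σ₀ hσ₀]
  refine ENNReal.le_of_forall_pos_le_add fun δ hδ _ => ?_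
  -- Four errors occur: two from replacing `c_ε` by `F` or back, and two from the approximating
  -- coupling.
  have hδ4 : 0 < δ / 4 := by positivity
  have hδ4' : ((δ / 4 : NNReal) : ℝ≥0∞) ≠ 0 := by simpa using hδ4.ne'
  have hthick : ∀ {θ : ι → ProbabilityMeasure Space3},
      (∀ᶠ i in L, (θ i : Measure Space3).support ⊆ N.thickened (e i)) →
      ∀ᶠ i in L, ∀ᵐ x ∂(θ i : Measure Space3), x ∈ N.thickened 1 := by
    intro θ hθ
    filter_upwards [hθ, (he.mono_right nhdsWithin_le_nhds).eventually_le_const zero_lt_one]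
      with i h1 h2
    exact (ae_mem_of_support_subset h1).mono fun x hx => N.thickened_mono h2 hx
  have happrox := eventually_exists_coupling_lintegral_le (N.isCompact_thickened 1) hμlim hνlim
    (hthick hμ) (hthick hν)
    ((ae_mem_of_support_subset hμ₀).mono fun x hx => N.carrier_subset_thickened zero_le_one hx)
    ((ae_mem_of_support_subset hν₀).mono fun x hx => N.carrier_subset_thickened zero_le_one hx)
    F hσ₀ hδ4
  refine le_of_tendsto (ProbabilityMeasure.tendsto_iff_forall_lintegral_tendsto.1 hlim F) ?_
  filter_upwards [happrox, hπ, hμ, hν, he.eventually (N.eventually_cost_le_add hF hδ4'),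
    (he.mono_right nhdsWithin_le_nhds).eventually (N.eventually_le_cost_add hF hδ4')]
    with i ⟨σ, hσ, hσle⟩ hi hμi hνi hup hlo
  have hmem : ∀ ρ ∈ couplings (μ i) (ν i), ∀ᵐ z ∂(ρ : Measure (Space3 × Space3)),
      z.1 ∈ N.thickened (e i) ∧ z.2 ∈ N.thickened (e i) := fun ρ hρ =>
    (ae_fst_of_mem_couplings hρ (ae_mem_of_support_subset hμi)).and
      (ae_snd_of_mem_couplings hρ (ae_mem_of_support_subset hνi))
  have hadd : ∀ ρ : ProbabilityMeasure (Space3 × Space3), ∀ c : Space3 × Space3 → ℝ≥0∞,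
      ∫⁻ z, (c z + ((δ / 4 : NNReal) : ℝ≥0∞)) ∂(ρ : Measure (Space3 × Space3)) =
        ∫⁻ z, c z ∂(ρ : Measure (Space3 × Space3)) + ((δ / 4 : NNReal) : ℝ≥0∞) := fun ρ c => by
    rw [lintegral_add_right _ measurable_const]
    simp
  calc ∫⁻ z, F z ∂(π i : Measure (Space3 × Space3))
      ≤ transportCost (N.cost (e i)) (π i) + ((δ / 4 : NNReal) : ℝ≥0∞) := by
        rw [transportCost, ← hadd]
        exact lintegral_mono_ae ((hmem _ hi.1).mono fun z hz => hlo z.1 hz.1 z.2 hz.2)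
    _ ≤ transportCost (N.cost (e i)) σ + ((δ / 4 : NNReal) : ℝ≥0∞) := by
        rw [hi.2]
        exact add_le_add (iInf₂_le σ hσ) le_rfl
    _ ≤ ∫⁻ z, F z ∂(σ : Measure (Space3 × Space3)) + ((δ / 4 : NNReal) : ℝ≥0∞) +
          ((δ / 4 : NNReal) : ℝ≥0∞) := by
        refine add_le_add ?_ le_rfl
        rw [← hadd]
        exact lintegral_mono_ae ((hmem _ hσ).mono fun z hz => hup z.1 hz.1 z.2 hz.2)
    _ ≤ ∫⁻ z, F z ∂(σ₀ : Measure (Space3 × Space3)) + ((δ / 4 : NNReal) : ℝ≥0∞) +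
          ((δ / 4 : NNReal) : ℝ≥0∞) + ((δ / 4 : NNReal) : ℝ≥0∞) +
          ((δ / 4 : NNReal) : ℝ≥0∞) := by
        gcongr
    _ = ∫⁻ z, F z ∂(σ₀ : Measure (Space3 × Space3)) + δ := by
        have : δ = δ / 4 + (δ / 4 + (δ / 4 + δ / 4)) := by
          rw [← NNReal.coe_inj]; push_cast; ring
        conv_rhs => rw [this]
        push_cast
        simp only [add_assoc]

end EmbeddedMetricGraph

/-- Probability measures concentrated on a fixed compact set have weak limits along ultrafilters. -/
lemma exists_tendsto_of_ae_mem_compact {ι : Type*} {L : Ultrafilter ι}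
    {K : Set (Space3 × Space3)} (hK : IsCompact K)
    {π : ι → ProbabilityMeasure (Space3 × Space3)}
    (hπ : ∀ᶠ i in (L : Filter ι), ∀ᵐ z ∂(π i : Measure (Space3 × Space3)), z ∈ K) :
    ∃ π₀, Tendsto π L (𝓝 π₀) := by
  set S : Set (ProbabilityMeasure (Space3 × Space3)) :=
    {ρ | ∀ᵐ z ∂(ρ : Measure (Space3 × Space3)), z ∈ K} with hS
  have hcomp : IsCompact (closure S) := by
    refine isCompact_closure_of_isTightMeasureSet
      (isTightMeasureSet_iff_exists_isCompact_measure_compl_le.2 fun η _ => ⟨K, hK, ?_⟩)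
    rintro _ ⟨ρ, hρ, rfl⟩
    exact (show (ρ : Measure (Space3 × Space3)) Kᶜ = 0 from hρ).le.trans bot_le
  obtain ⟨π₀, -, h⟩ := hcomp.ultrafilter_le_nhds' (L.map π)
    (mem_of_superset (x := S) hπ subset_closure)
  exact ⟨π₀, h⟩

theorem mainTheorem1 {V : Type*} [Finite V] (N : EmbeddedMetricGraph V)
    (I : Set ℝ) (hI : I ⊆ Set.Ioi 0) (hI0 : (0 : ℝ) ∈ closure I)
    (μ ν : ℝ → ProbabilityMeasure Space3) (μ₀ ν₀ : ProbabilityMeasure Space3)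
    (hμ : ∀ ε ∈ I, (μ ε : Measure Space3).support ⊆ N.thickened ε)
    (hν : ∀ ε ∈ I, (ν ε : Measure Space3).support ⊆ N.thickened ε)
    (hμ₀ : (μ₀ : Measure Space3).support ⊆ N.carrier)
    (hν₀ : (ν₀ : Measure Space3).support ⊆ N.carrier)
    (hμlim : Tendsto μ (𝓝[I] 0) (𝓝 μ₀))
    (hνlim : Tendsto ν (𝓝[I] 0) (𝓝 ν₀))
    (π : ℝ → ProbabilityMeasure (Space3 × Space3))
    (hπ : ∀ ε ∈ I, IsOptimalCoupling (N.cost ε) (μ ε) (ν ε) (π ε)) :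
    (∀ (e : ℕ → ℝ) (π₀ : ProbabilityMeasure (Space3 × Space3)),
        (∀ k, e k ∈ I) → Tendsto e atTop (𝓝 0) →
        Tendsto (fun k => π (e k)) atTop (𝓝 π₀) →
        IsOptimalCoupling (N.cost 0) μ₀ ν₀ π₀) ∧
      (∀ π₀ : ProbabilityMeasure (Space3 × Space3),
        IsOptimalCoupling (N.cost 0) μ₀ ν₀ π₀ →
        (∀ σ, IsOptimalCoupling (N.cost 0) μ₀ ν₀ σ → σ = π₀) →
        Tendsto π (𝓝[I] 0) (𝓝 π₀)) := by
  have hle : 𝓝[I] (0 : ℝ) ≤ 𝓝[>] 0 := nhdsWithin_mono 0 hI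
  constructor
  · intro e π₀ heI he hlim
    have heI' : Tendsto e atTop (𝓝[I] 0) :=
      tendsto_nhdsWithin_iff.2 ⟨he, Eventually.of_forall heI⟩
    exact N.isOptimalCoupling_of_tendsto (heI'.mono_right hle)
      (Eventually.of_forall fun k => hμ _ (heI k)) (Eventually.of_forall fun k => hν _ (heI k))
      hμ₀ hν₀ (hμlim.comp heI') (hνlim.comp heI') (Eventually.of_forall fun k => hπ _ (heI k)) hlim
  · intro π₀ _ huniq
    -- Each ultrafilter finer than `𝓝[I] 0` yields a weak limit by tightness; that limit is optimal,
    -- hence equal to `π₀`.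
    rw [tendsto_iff_ultrafilter]
    intro L hL
    have hLI : ∀ᶠ ε in (L : Filter ℝ), ε ∈ I := hL self_mem_nhdsWithin
    have hL1 : ∀ᶠ ε : ℝ in (L : Filter ℝ), ε ≤ 1 :=
      (hL.trans nhdsWithin_le_nhds) (Iic_mem_nhds zero_lt_one)
    obtain ⟨σ, hσ⟩ := exists_tendsto_of_ae_mem_compact (L := L) (π := π)
      ((N.isCompact_thickened 1).prod (N.isCompact_thickened 1)) (by
        filter_upwards [hLI, hL1] with ε h1 h2
        filter_upwards [ae_fst_of_mem_couplings (hπ ε h1).1 (ae_mem_of_support_subset (hμ ε h1)),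
          ae_snd_of_mem_couplings (hπ ε h1).1 (ae_mem_of_support_subset (hν ε h1))] with z hz1 hz2
        exact ⟨N.thickened_mono h2 hz1, N.thickened_mono h2 hz2⟩)
    have hopt := N.isOptimalCoupling_of_tendsto (L := (L : Filter ℝ)) (e := fun ε => ε)
      (hL.trans hle) (hLI.mono hμ) (hLI.mono hν) hμ₀ hν₀ (hμlim.mono_left hL) (hνlim.mono_left hL)
      (hLI.mono hπ) hσ
    rwa [huniq σ hopt] at hσ
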